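/- **Setup.** Let $R$ be a commutative ring. For an ideal $I\le R[x_1,\dots,x_n]$, let $\operatorname{init} I$ be the ideal spanned by the lexicographic leading terms (coefficients included, with $x_1>x_2>\dots>x_n$) of the elements of $I$. If $Y=V(I)$, then $\operatorname{init}Y:=V(\operatorname{init}I)$ is its *initial scheme*. A closed subscheme of $\mathbb A^n_R$ is *Stanley–Reisner* if its ideal is generated by squarefree monomials ($1$ is allowed). For $f\in R[x_1,\dots,x_n]$, the schemes *constructed from $f=0$* are those obtained from $\{f=0\}\subseteq\mathbb A^n_R$ by finitely often taking prime components, pairwise scheme-theoretic intersections and pairwise unions. For a prime $p$, let $\mathrm{Tr}$ be the $\mathbb F_p$-linear endomorphism of $\mathbb F_p[x_1,\dots,x_n]$ with $\mathrm{Tr}(m)=\sqrt[p]{m\prod_i x_i}\,/\prod_i x_i$ if $m$ is a monomial such that $m\prod_i x_i$ is a $p$-th power, and $\mathrm{Tr}(m)=0$ for all other monomials $m$. The scheme $V(I)$, $I\le\mathbb F_p[x_1,\dots,x_n]$, is *compatibly split by $\mathrm{Tr}(f^{p-1}\bullet)$* if $\mathrm{Tr}(f^{p-1}g)\in I$ for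 all $g\in I$. A self-map of $\mathbb A^n_k$ ($k$ a field), given as a map on $\bar k$-points, is *constructible* if $\mathbb A^n_k$ is covered by finitely many locally closed subsets defined over $k$ on each of which the map is given by regular functions defined over $k$. **Theorem 1.7.** Let $f\in\mathbb Z[x_1,\dots,x_n]$ be a polynomial of degree $k$ whose lexicographic leading term is a nonzero integer multiple of a product of $k$ distinct variables. Then there is an integer $N\ge 1$ such that the following hold. 1. For every scheme $Y\subseteq\mathbb A^n_{\mathbb Z}$ constructed from $f=0$, the base change $Y_R$ to $R=\mathbb Z[1/N]$ and the base change to $R=\mathbb Q$ are reduced, and $\operatorname{init}(Y_R)$ is a Stanley–Reisner scheme over $R$. 2. There is a bijective constructible map $\mathbb A^n_{\mathbb Q}\to\mathbb A^n_{\mathbb Q}$ taking $Y_{\mathbb Q}$ into $\operatorname{init}(Y_{\mathbb Q})$ for all $Y$ constructed from $f=0$ simultaneously. 3. For every prime $p\nmid N$, let $\mathcal Y_p$ be the set of closed subschemes of $\mathbb A^n_{\mathbb F_p}$ consisting of the reductions mod $p$ of the schemes constructed from $f=0$ over $\mathbb Z$, the schemes constructed from $(f \bmod p)=0$ over $\mathbb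 F_p$, and all schemes compatibly split by $\mathrm{Tr}(f^{p-1}\bullet)$. Every $Y\in\mathcal Y_p$ is reduced, and $\operatorname{init}Y$ is Stanley–Reisner. There is a bijective constructible map $\mathbb A^n_{\mathbb F_p}\to\mathbb A^n_{\mathbb F_p}$ taking $Y$ into $\operatorname{init}Y$ for all $Y\in\mathcal Y_p$ simultaneously. -/

import Mathlib

open MvPolynomial

noncomputable section

namespace FrobDegen

/-- The closed subschemes of affine `n`-space over `R` (given by their ideals) that are constructed
from the hypersurface `f = 0` by taking (prime) components, intersections and unions, repeatedly.
Components of `V(I)` are the `V(P)` for `P` a minimal prime of `I`; the ideal of an intersection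
is the sum of the ideals, and the ideal of a union is the intersection of the ideals. -/
inductive Constructed {R : Type*} [CommRing R] {n : ℕ} (f : MvPolynomial (Fin n) R) :
    Ideal (MvPolynomial (Fin n) R) → Prop
  | hypersurface : Constructed f (Ideal.span {f})
  | component {I P : Ideal (MvPolynomial (Fin n) R)} :
      Constructed f I → P ∈ I.minimalPrimes → Constructed f P
  | intersection {I J : Ideal (MvPolynomial (Fin n) R)} :
      Constructed f I → Constructed f J → Constructed f (I ⊔ J)
  | union {I J : Ideal (MvPolynomial (Fin n) R)} :
      Constructed f I → Constructed f J → Constructed f (I ⊓ J)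

/-- The map `Tr` on `𝔽_p[x₁, …, xₙ]`: a monomial `m` with `m ∏ xᵢ` a `p`-th power goes to
`(m ∏ xᵢ)^(1/p) / ∏ xᵢ`, and every other monomial goes to `0`. (On `𝔽_p` the `p`-th root is the
identity, so `Tr` is `𝔽_p`-linear.) -/
def trace (p n : ℕ) : MvPolynomial (Fin n) (ZMod p) →ₗ[ZMod p] MvPolynomial (Fin n) (ZMod p) :=
  (basisMonomials (Fin n) (ZMod p)).constr (ZMod p) fun e =>
    if ∀ i, p ∣ e i + 1 then
      monomial (Finsupp.equivFunOnFinite.symm fun i => (e i + 1) / p - 1) 1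
    else 0

/-- The ideal `I` is compatibly split by the (near-)splitting `g ↦ Tr (f ^ (p - 1) g)`, i.e. this
map carries `I` into itself. -/
def IsCompatiblySplit (p : ℕ) {n : ℕ} (f : MvPolynomial (Fin n) (ZMod p))
    (I : Ideal (MvPolynomial (Fin n) (ZMod p))) : Prop :=
  ∀ g ∈ I, trace p n (f ^ (p - 1) * g) ∈ I

/-- The lexicographic initial ideal of `I` (with `x₁ > x₂ > ⋯ > xₙ`), generated by the lex leading
terms (coefficients included) of the elements of `I`. -/
def initialIdeal {R : Type*} [CommRing R] {n : ℕ} (I : Ideal (MvPolynomial (Fin n) R)) :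
    Ideal (MvPolynomial (Fin n) R) :=
  Ideal.span ((fun g => MonomialOrder.lex.leadingTerm g) '' (I : Set (MvPolynomial (Fin n) R)))

/-- A Stanley–Reisner ideal: one generated by a set of squarefree monomials. -/
def IsStanleyReisner {R : Type*} [CommRing R] {n : ℕ} (I : Ideal (MvPolynomial (Fin n) R)) :
    Prop :=
  ∃ S : Set (Finset (Fin n)), I = Ideal.span ((fun A => ∏ i ∈ A, X i) '' S)

/-- A constructible self-map of affine `n`-space over the field `k`, as a map on geometric points:
affine space is covered by finitely many locally closed subsets `V(J a) ∩ {h a ≠ 0}` defined over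
`k`, and on each of them the map is given by regular functions `g a j / h a` defined over `k`. -/
def IsConstructibleMap (k : Type*) [Field k] {n : ℕ}
    (φ : (Fin n → AlgebraicClosure k) → (Fin n → AlgebraicClosure k)) : Prop :=
  ∃ (m : ℕ) (J : Fin m → Ideal (MvPolynomial (Fin n) k)) (h : Fin m → MvPolynomial (Fin n) k)
    (g : Fin m → Fin n → MvPolynomial (Fin n) k),
    (∀ x, ∃ a, x ∈ zeroLocus (AlgebraicClosure k) (J a) ∧ aeval x (h a) ≠ 0) ∧
    ∀ a, ∀ x ∈ zeroLocus (AlgebraicClosure k) (J a), aeval x (h a) ≠ 0 →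
      ∀ j, φ x j = aeval x (g a j) / aeval x (h a)

/-- There is one bijective constructible self-map of affine `n`-space over `k` taking `V(I)` into
`V(init I)`, simultaneously for all ideals `I` in the family `F`. -/
def HasBijectionIntoInitial (k : Type*) [Field k] {n : ℕ}
    (F : Set (Ideal (MvPolynomial (Fin n) k))) : Prop :=
  ∃ φ : (Fin n → AlgebraicClosure k) → (Fin n → AlgebraicClosure k),
    Function.Bijective φ ∧ IsConstructibleMap k φ ∧
    ∀ I ∈ F, Set.MapsTo φ (zeroLocus (AlgebraicClosure k) I)
      (zeroLocus (AlgebraicClosure k) (initialIdeal I))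

/-- The scheme `V(I)` is reduced and its initial scheme is Stanley–Reisner. -/
def IsReducedWithSRInitial {R : Type*} [CommRing R] {n : ℕ}
    (I : Ideal (MvPolynomial (Fin n) R)) : Prop :=
  IsReduced (MvPolynomial (Fin n) R ⧸ I) ∧ IsStanleyReisner (initialIdeal I)

/-- Base change of a closed subscheme of affine `n`-space along `R → S`. -/
def baseChange {R S : Type*} [CommRing R] [CommRing S] (ρ : R →+* S) {n : ℕ}
    (I : Ideal (MvPolynomial (Fin n) R)) : Ideal (MvPolynomial (Fin n) S) :=
  I.map (map ρ)

/-- The ideals over `ℚ` of the schemes constructed (over `ℤ`) from the hypersurface `f = 0`. -/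
def rationalFamily {n : ℕ} (f : MvPolynomial (Fin n) ℤ) :
    Set (Ideal (MvPolynomial (Fin n) ℚ)) :=
  baseChange (Int.castRingHom ℚ) '' {I | Constructed f I}

/-- The ideals over `𝔽_p` of: the reductions mod `p` of the schemes constructed over `ℤ` from
`f = 0`; the schemes constructed over `𝔽_p` from `f = 0`; and all schemes compatibly split by
`Tr (f ^ (p - 1) •)`. -/
def modPFamily (p : ℕ) {n : ℕ} (f : MvPolynomial (Fin n) ℤ) :
    Set (Ideal (MvPolynomial (Fin n) (ZMod p))) :=
  baseChange (Int.castRingHom (ZMod p)) '' {I | Constructed f I} ∪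
    {I | Constructed (map (Int.castRingHom (ZMod p)) f) I} ∪
    {I | IsCompatiblySplit p (map (Int.castRingHom (ZMod p)) f) I}

end FrobDegen

end

noncomputable section

namespace FrobDegen

/-! In characteristic p the engine is that `trace` respects the lex order on the monomials it does
not kill. Let I be stable under Tr(f^(p-1) •) and let u ∈ I have leading exponent d. Since the
leading monomial of f is squarefree, for every e with d ≤ p e some monomial multiple of f^(p-1) u
has leading exponent p(e+1)-1, and its trace lies in I with leading exponent e. Iterating e = ⌈d/p⌉
ends at the indicator of the support of d (`IsCompatiblySplit.exists_degree_squarefree`). So I has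
squarefree leading monomials, and division shows that it is radical. Stability under the trace
survives sums, intersections and minimal primes.

Over ℤ, each constructed ideal has compatibly split reductions modulo large p
(`Constructed.eventually_isCompatiblySplit`), with a bound depending on the ideal; squarefree leads
then pass to ℚ. A family closed under intersection whose members have squarefree leads is finite
(`finite_of_hasSquarefreeLeads`), so only finitely many ideals occur over ℚ. This yields one N for
all of them (`exists_isGoodModulus`).

The bijection degenerates one variable at a time. On a line parallel to the i-th axis, the i-th
partial leading forms of a squarefree basis are linear in the coordinate, so a locus contains the
line, misses it or meets it in one point. By multiplying elements of I and J inside I ⊓ J one sees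
that this point is the same for all members of the family (`eq_of_aeval_slope_ne_zero`). Translating
it to 0 on every line is a bijective shear, and the n shears are composed. -/

/-- The exponent vector of the squarefree monomial `∏ i ∈ A, X i`. -/
def squarefreeExp {σ : Type*} (A : Finset σ) : σ →₀ ℕ :=
  Finsupp.indicator A fun _ _ => 1

open Classical in
theorem squarefreeExp_apply {σ : Type*} (A : Finset σ) (i : σ) :
    squarefreeExp A i = if i ∈ A then 1 else 0 := by
  simp [squarefreeExp, Finsupp.indicator_apply]

@[simp]
theorem support_squarefreeExp {σ : Type*} (A : Finset σ) : (squarefreeExp A).support = A := by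
  classical
  ext i
  simp [squarefreeExp_apply]

theorem squarefreeExp_support_le {σ : Type*} (e : σ →₀ ℕ) : squarefreeExp e.support ≤ e := by
  classical
  intro i
  rw [squarefreeExp_apply]
  split_ifs with h
  · exact Nat.one_le_iff_ne_zero.2 (Finsupp.mem_support_iff.1 h)
  · exact Nat.zero_le _

theorem monomial_squarefreeExp {σ R : Type*} [CommRing R] (A : Finset σ) :
    monomial (squarefreeExp A) (1 : R) = ∏ i ∈ A, X i := by
  classical
  rw [monomial_eq, C_1, one_mul, Finsupp.prod, support_squarefreeExp]
  refine Finset.prod_congr rfl fun i hi => ?_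
  rw [squarefreeExp_apply, if_pos hi, pow_one]

/-! ### Ideals with squarefree leading monomials. -/

section Leads

variable {σ R : Type*} [CommRing R] (m : MonomialOrder σ)

/-- Cancelling the leading term lowers the degree. -/
theorem degree_sub_lt_of_coeff_eq {u w : MvPolynomial σ R}
    (hd : m.toSyn (m.degree w) ≤ m.toSyn (m.degree u))
    (hc : coeff (m.degree u) w = m.leadingCoeff u) (hne : u - w ≠ 0) :
    m.toSyn (m.degree (u - w)) < m.toSyn (m.degree u) := by
  refine lt_of_le_of_ne (m.degree_sub_le.trans (sup_le le_rfl hd)) fun h => ?_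
  have h1 : m.degree (u - w) = m.degree u := m.toSyn.injective h
  refine m.leadingCoeff_ne_zero_iff.2 hne ?_
  rw [MonomialOrder.leadingCoeff, h1, coeff_sub, hc, MonomialOrder.leadingCoeff, sub_self]

variable [IsDomain R]

theorem degree_monomial_mul {b : σ →₀ ℕ} {a : R} (ha : a ≠ 0) {h : MvPolynomial σ R}
    (hh : h ≠ 0) : m.degree (monomial b a * h) = b + m.degree h := by
  classical
  rw [m.degree_mul (by simpa using ha) hh, m.degree_monomial, if_neg ha]

/-- One step of division by a polynomial with leading coefficient one. -/
theorem degree_sub_monomial_mul_lt {u h : MvPolynomial σ R} (hu : u ≠ 0) (hh : m.Monic h)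
    (hle : m.degree h ≤ m.degree u)
    (hne : u - monomial (m.degree u - m.degree h) (m.leadingCoeff u) * h ≠ 0) :
    m.toSyn (m.degree (u - monomial (m.degree u - m.degree h) (m.leadingCoeff u) * h)) <
      m.toSyn (m.degree u) := by
  have hd : m.degree (monomial (m.degree u - m.degree h) (m.leadingCoeff u) * h) = m.degree u := by
    rw [degree_monomial_mul m (m.leadingCoeff_ne_zero_iff.2 hu) hh.ne_zero,
      tsub_add_cancel_of_le hle]
  refine degree_sub_lt_of_coeff_eq m (congrArg m.toSyn hd).le ?_ hne
  have hc : m.leadingCoeff (monomial (m.degree u - m.degree h) (m.leadingCoeff u) * h) =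
      m.leadingCoeff u := by
    rw [m.leadingCoeff_mul, m.leadingCoeff_monomial, hh.leadingCoeff_eq_one, mul_one]
  rwa [MonomialOrder.leadingCoeff, hd] at hc

/-- The leading monomials of the ideal form a squarefree monomial ideal, and they are attained
with leading coefficient one. -/
def HasSquarefreeLeads (I : Ideal (MvPolynomial σ R)) : Prop :=
  ∀ u ∈ I, u ≠ 0 → ∃ h ∈ I, m.Monic h ∧ m.degree h = squarefreeExp (m.degree u).support

variable {m}

/-- The sets `A` such that `∏ i ∈ A, X i` is the leading monomial of an element of `I` with leading
coefficient one. -/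
def squarefreeLeads (m : MonomialOrder σ) (I : Ideal (MvPolynomial σ R)) : Set (Finset σ) :=
  {A | ∃ u ∈ I, m.Monic u ∧ m.degree u = squarefreeExp A}

variable (m) in
/-- A set of elements of `I` with squarefree leading monomials and leading coefficient one that
generate the leading monomials of `I`. -/
structure IsSquarefreeBasis (I : Ideal (MvPolynomial σ R)) (B : Set (MvPolynomial σ R)) :
    Prop where
  mem : ∀ h ∈ B, h ∈ I
  monic : ∀ h ∈ B, m.Monic h
  degree_eq : ∀ h ∈ B, m.degree h = squarefreeExp (m.degree h).support
  exists_degree_eq : ∀ u ∈ I, u ≠ 0 → ∃ h ∈ B, m.degree h = squarefreeExp (m.degree u).support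

/-- This is the division algorithm as an induction principle: u is rebuilt by adding monomial
multiples of basis elements, each of larger degree than what is already there. -/
theorem IsSquarefreeBasis.induction {I : Ideal (MvPolynomial σ R)} {B : Set (MvPolynomial σ R)}
    (hB : IsSquarefreeBasis m I B) {Q : MvPolynomial σ R → Prop} (zero : Q 0)
    (step : ∀ v h : MvPolynomial σ R, ∀ b a, v ∈ I → h ∈ B → a ≠ 0 →
      (v ≠ 0 → m.toSyn (m.degree v) < m.toSyn (b + m.degree h)) →
      m.degree (v + monomial b a * h) = b + m.degree h → Q v → Q (v + monomial b a * h))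
    {u : MvPolynomial σ R} (hu : u ∈ I) : Q u := by
  induction hd : m.toSyn (m.degree u) using WellFoundedLT.induction generalizing u with
  | ind d ih =>
    by_cases hu0 : u = 0
    · rwa [hu0]
    obtain ⟨h, hh, hdeg⟩ := hB.exists_degree_eq u hu hu0
    have hle : m.degree h ≤ m.degree u := hdeg ▸ squarefreeExp_support_le _
    have hlt := degree_sub_monomial_mul_lt m hu0 (hB.monic h hh) hle
    have hv : u - monomial (m.degree u - m.degree h) (m.leadingCoeff u) * h ∈ I :=
      I.sub_mem hu (I.mul_mem_left _ (hB.mem h hh))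
    have h1 := step _ h (m.degree u - m.degree h) (m.leadingCoeff u) hv hh
      (m.leadingCoeff_ne_zero_iff.2 hu0) (by rwa [tsub_add_cancel_of_le hle])
      (by rw [sub_add_cancel, tsub_add_cancel_of_le hle])
    rw [sub_add_cancel] at h1
    refine h1 ?_
    by_cases hv0 : u - monomial (m.degree u - m.degree h) (m.leadingCoeff u) * h = 0
    · rwa [hv0]
    · exact ih _ (hd ▸ hlt hv0) hv rfl

omit [IsDomain R] in
theorem HasSquarefreeLeads.exists_finite_isSquarefreeBasis [Finite σ]
    {I : Ideal (MvPolynomial σ R)} (hI : HasSquarefreeLeads m I) :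
    ∃ B : Set (MvPolynomial σ R), B.Finite ∧ IsSquarefreeBasis m I B := by
  choose! h hI' hmon hdeg using
    fun A (hA : A ∈ squarefreeLeads m I) => hA
  refine ⟨h '' squarefreeLeads m I, (Set.toFinite _).image h, ?_, ?_, ?_, fun u hu hu0 => ?_⟩
  · rintro _ ⟨A, hA, rfl⟩
    exact hI' A hA
  · rintro _ ⟨A, hA, rfl⟩
    exact hmon A hA
  · rintro _ ⟨A, hA, rfl⟩
    rw [hdeg A hA, support_squarefreeExp]
  · have hA : (m.degree u).support ∈ squarefreeLeads m I := hI u hu hu0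
    exact ⟨_, ⟨_, hA, rfl⟩, hdeg _ hA⟩

/-- The exponents of u ^ k and u have the same support, so a squarefree lead obtained from u ^ k
already divides the leading monomial of u. Subtracting the corresponding element w of I lowers the
degree and leaves the k-th power in I. -/
theorem HasSquarefreeLeads.isRadical {I : Ideal (MvPolynomial σ R)}
    (hI : HasSquarefreeLeads m I) : I.IsRadical := by
  rintro u ⟨k, hu⟩
  rcases Nat.eq_zero_or_pos k with rfl | hk
  · rw [pow_zero] at hu
    rw [(Ideal.eq_top_iff_one I).2 hu]
    trivial
  induction hd : m.toSyn (m.degree u) using WellFoundedLT.induction generalizing u with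
  | ind d ih =>
    by_cases hu0 : u = 0
    · rw [hu0]; exact I.zero_mem
    obtain ⟨h, hh, hmon, hdeg⟩ := hI _ hu (pow_ne_zero _ hu0)
    rw [m.degree_pow, Finsupp.support_smul_eq hk.ne'] at hdeg
    have hle : m.degree h ≤ m.degree u := hdeg ▸ squarefreeExp_support_le _
    have hw : monomial (m.degree u - m.degree h) (m.leadingCoeff u) * h ∈ I := I.mul_mem_left _ hh
    have hlt := degree_sub_monomial_mul_lt m hu0 hmon hle
    generalize monomial (m.degree u - m.degree h) (m.leadingCoeff u) * h = w at hw hlt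
    by_cases hv0 : u - w = 0
    · rwa [sub_eq_zero.1 hv0]
    have hv : (u - w) ^ k ∈ I := by
      have h1 : (u - w) ^ k - u ^ k ∈ I := by
        refine I.mem_of_dvd (sub_dvd_pow_sub_pow (u - w) u k) ?_
        rw [sub_sub_cancel_left]
        exact I.neg_mem hw
      simpa using I.add_mem h1 hu
    simpa using I.add_mem (ih _ (hd ▸ hlt hv0) hv rfl) hw

/-- Elements of J can be divided by elements of I, and the remainders stay in J. -/
theorem HasSquarefreeLeads.eq_of_le {I J : Ideal (MvPolynomial σ R)}
    (hJ : HasSquarefreeLeads m J) (hIJ : I ≤ J)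
    (h : ∀ A, (∃ u ∈ J, m.Monic u ∧ m.degree u = squarefreeExp A) →
      ∃ u ∈ I, m.Monic u ∧ m.degree u = squarefreeExp A) : I = J := by
  have hI : ∀ u ∈ J, u ≠ 0 →
      ∃ h ∈ I, m.Monic h ∧ m.degree h = squarefreeExp (m.degree u).support :=
    fun u hu hu0 => h _ (hJ u hu hu0)
  refine le_antisymm hIJ fun u hu => ?_
  induction hd : m.toSyn (m.degree u) using WellFoundedLT.induction generalizing u with
  | ind d ih =>
    by_cases hu0 : u = 0
    · rw [hu0]; exact I.zero_mem
    obtain ⟨h, hh, hmon, hdeg⟩ := hI _ hu hu0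
    have hle : m.degree h ≤ m.degree u := hdeg ▸ squarefreeExp_support_le _
    have hw : monomial (m.degree u - m.degree h) (m.leadingCoeff u) * h ∈ I := I.mul_mem_left _ hh
    have hlt := degree_sub_monomial_mul_lt m hu0 hmon hle
    generalize monomial (m.degree u - m.degree h) (m.leadingCoeff u) * h = w at hw hlt
    by_cases hv0 : u - w = 0
    · rwa [sub_eq_zero.1 hv0]
    simpa using I.add_mem (ih _ (hd ▸ hlt hv0) _ (J.sub_mem hu (hIJ hw)) rfl) hw

/-- If u ∈ I and v ∈ J have leading exponent 1_A, then u v ∈ I ⊓ J has leading exponent 2 · 1_A,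
whose support is again A. -/
theorem HasSquarefreeLeads.squarefreeLeads_inf {I J : Ideal (MvPolynomial σ R)}
    (hIJ : HasSquarefreeLeads m (I ⊓ J)) (h : squarefreeLeads m I = squarefreeLeads m J) :
    squarefreeLeads m (I ⊓ J) = squarefreeLeads m J := by
  ext A
  constructor
  · rintro ⟨u, hu, h1⟩
    exact ⟨u, hu.2, h1⟩
  · intro hA
    obtain ⟨v, hv, hvm, hvd⟩ := hA
    obtain ⟨u, hu, hum, hud⟩ : A ∈ squarefreeLeads m I := h ▸ ⟨v, hv, hvm, hvd⟩
    obtain ⟨w, hw, hwm, hwd⟩ := hIJ (u * v) ⟨I.mul_mem_right _ hu, J.mul_mem_left _ hv⟩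
      (mul_ne_zero hum.ne_zero hvm.ne_zero)
    refine ⟨w, hw, hwm, ?_⟩
    rw [hwd, m.degree_mul hum.ne_zero hvm.ne_zero, hud, hvd, ← two_nsmul,
      Finsupp.support_smul_eq two_ne_zero, support_squarefreeExp]

/-- A family of ideals with squarefree leading monomials that is closed under intersection is
finite. -/
theorem finite_of_hasSquarefreeLeads [Finite σ] {F : Set (Ideal (MvPolynomial σ R))}
    (hF : ∀ I ∈ F, HasSquarefreeLeads m I) (hinf : ∀ I ∈ F, ∀ J ∈ F, I ⊓ J ∈ F) : F.Finite := by
  -- The map sending I to its set of squarefree leads, a set of subsets of the variables, is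
  -- injective on F: both I and J equal I ⊓ J when their leads agree.
  refine Set.Finite.of_finite_image (f := squarefreeLeads m) (Set.toFinite _) ?_
  intro I hI J hJ h
  have hIJ := hF _ (hinf I hI J hJ)
  have h1 : I ⊓ J = J := (hF J hJ).eq_of_le inf_le_right fun A hA => by
    change A ∈ squarefreeLeads m (I ⊓ J)
    rw [hIJ.squarefreeLeads_inf h]
    exact hA
  have h2 : I ⊓ J = I := (hF I hI).eq_of_le inf_le_left fun A hA => by
    change A ∈ squarefreeLeads m (I ⊓ J)
    rw [hIJ.squarefreeLeads_inf h, ← h]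
    exact hA
  exact h2.symm.trans h1

end Leads

theorem HasSquarefreeLeads.isReducedWithSRInitial {R : Type*} [CommRing R] [IsDomain R] {n : ℕ}
    {I : Ideal (MvPolynomial (Fin n) R)} (hI : HasSquarefreeLeads MonomialOrder.lex I) :
    IsReducedWithSRInitial I := by
  refine ⟨(Ideal.isRadical_iff_quotient_reduced I).1 hI.isRadical,
    squarefreeLeads MonomialOrder.lex I, le_antisymm ?_ ?_⟩
  · rw [initialIdeal, Ideal.span_le]
    rintro _ ⟨u, hu, rfl⟩
    by_cases hu0 : u = 0
    · simp [hu0]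
    have hA : (MonomialOrder.lex.degree u).support ∈ squarefreeLeads MonomialOrder.lex I :=
      hI u hu hu0
    have h1 := Ideal.subset_span (α := MvPolynomial (Fin n) R)
      (Set.mem_image_of_mem (fun A => ∏ i ∈ A, X i) hA)
    simp only [MonomialOrder.leadingTerm]
    rw [← tsub_add_cancel_of_le (squarefreeExp_support_le (MonomialOrder.lex.degree u)),
      ← mul_one (MonomialOrder.lex.leadingCoeff u), ← monomial_mul, monomial_squarefreeExp]
    exact Ideal.mul_mem_left _ _ h1
  · rw [initialIdeal, Ideal.span_le]
    rintro _ ⟨A, ⟨u, hu, hmon, hdeg⟩, rfl⟩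
    refine Ideal.subset_span ⟨u, hu, ?_⟩
    simp only [MonomialOrder.leadingTerm]
    rw [hmon.leadingCoeff_eq_one, hdeg, monomial_squarefreeExp]

/-- In the localization at P the extension of I has the maximal ideal as its radical, so g becomes
nilpotent modulo I there. -/
theorem exists_mul_pow_mem_of_mem_minimalPrimes {S : Type*} [CommRing S] {I P : Ideal S}
    (hP : P ∈ I.minimalPrimes) {g : S} (hg : g ∈ P) : ∃ h ∉ P, ∃ k, (h * g) ^ k ∈ I := by
  have := hP.1.1
  have h1 : algebraMap S (Localization.AtPrime P) g ∈
      (I.map (algebraMap S (Localization.AtPrime P))).radical := by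
    rw [IsLocalization.AtPrime.radical_map_of_mem_minimalPrimes _ _ _ hP]
    exact Ideal.mem_map_of_mem _ hg
  obtain ⟨k, hk⟩ := h1
  rw [← map_pow, IsLocalization.algebraMap_mem_map_algebraMap_iff P.primeCompl] at hk
  obtain ⟨h, hh, hk⟩ := hk
  refine ⟨h, hh, k, ?_⟩
  have hk0 : k ≠ 0 := by
    rintro rfl
    rw [pow_zero, mul_one] at hk
    exact hh (hP.1.2 hk)
  rw [mul_pow, ← pow_sub_one_mul hk0 h, mul_assoc]
  exact I.mul_mem_left _ hk

/-! ### Compatibly split ideals in characteristic p. -/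

section Trace

variable {p n : ℕ}

/-- The exponent `p (e + 1) - 1`, whose monomial is sent by `trace` to the monomial of `e`. -/
def traceExp (p : ℕ) (e : Fin n →₀ ℕ) : Fin n →₀ ℕ :=
  Finsupp.equivFunOnFinite.symm fun i => p * e i + (p - 1)

@[simp]
theorem traceExp_apply (e : Fin n →₀ ℕ) (i : Fin n) : traceExp p e i = p * e i + (p - 1) := rfl

theorem coeff_trace [Fact p.Prime] (F : MvPolynomial (Fin n) (ZMod p)) (e : Fin n →₀ ℕ) :
    coeff e (trace p n F) = coeff (traceExp p e) F := by
  classical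
  have hp : 0 < p := (Fact.out : p.Prime).pos
  induction F using MvPolynomial.induction_on' with
  | add F G hF hG => rw [map_add, coeff_add, coeff_add, hF, hG]
  | monomial d a =>
    have h1 : monomial d a = a • basisMonomials (Fin n) (ZMod p) d := by
      rw [coe_basisMonomials, smul_monomial, smul_eq_mul, mul_one]
    have h2 : trace p n (monomial d a) = a • (if ∀ i, p ∣ d i + 1 then
      monomial (Finsupp.equivFunOnFinite.symm fun i => (d i + 1) / p - 1) 1 else 0) := by
      rw [h1, map_smul, trace, Module.Basis.constr_basis]
    rw [h2, coeff_smul, coeff_monomial]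
    by_cases hd : d = traceExp p e
    · subst hd
      have h3 : ∀ i, traceExp p e i + 1 = p * (e i + 1) := fun i => by
        rw [traceExp_apply, mul_add, mul_one]; omega
      have h4 : (Finsupp.equivFunOnFinite.symm fun i => (traceExp p e i + 1) / p - 1) = e := by
        ext i
        simp only [Finsupp.equivFunOnFinite_symm_apply_apply, h3, Nat.mul_div_cancel_left _ hp,
          Nat.add_sub_cancel]
      rw [if_pos fun i => ⟨_, h3 i⟩, if_pos rfl, h4, coeff_monomial, if_pos rfl, smul_eq_mul,
        mul_one]
    · rw [if_neg hd]
      split_ifs with h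
      · rw [coeff_monomial, if_neg, smul_zero]
        intro h5
        refine hd (Finsupp.ext fun i => ?_)
        obtain ⟨k, hk⟩ := h i
        have h6 : (d i + 1) / p - 1 = e i := DFunLike.congr_fun h5 i
        rw [hk, Nat.mul_div_cancel_left _ hp] at h6
        have hk0 : k ≠ 0 := by rintro rfl; omega
        obtain ⟨l, rfl⟩ := Nat.exists_eq_succ_of_ne_zero hk0
        rw [traceExp_apply, ← h6]
        simp only [Nat.succ_eq_add_one, Nat.add_sub_cancel, mul_add, mul_one] at hk ⊢
        omega
      · simp

/-- This is p⁻¹-linearity; coefficients need no p-th root because Frobenius is the identity on 𝔽_p.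
-/
theorem trace_pow_mul [Fact p.Prime] (h g : MvPolynomial (Fin n) (ZMod p)) :
    trace p n (h ^ p * g) = h * trace p n g := by
  classical
  have hp : 0 < p := (Fact.out : p.Prime).pos
  induction h using MvPolynomial.induction_on' with
  | add F G hF hG => rw [add_pow_char, add_mul, map_add, hF, hG, add_mul]
  | monomial b a =>
    rw [monomial_pow, ZMod.pow_card]
    ext e
    rw [coeff_trace, coeff_monomial_mul', coeff_monomial_mul']
    have h1 : p • b ≤ traceExp p e ↔ b ≤ e := by
      refine forall_congr' fun i => ?_
      simp only [Finsupp.smul_apply, smul_eq_mul, traceExp_apply]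
      constructor
      · intro h
        by_contra! hlt
        have := Nat.mul_le_mul_left p (Nat.succ_le_of_lt hlt)
        rw [Nat.succ_eq_add_one, mul_add] at this
        omega
      · intro h
        have := Nat.mul_le_mul_left p h
        omega
    simp only [h1]
    split_ifs with h
    · rw [coeff_trace]
      congr 2
      ext i
      simp only [Finsupp.coe_tsub, Finsupp.coe_smul, Pi.sub_apply, Pi.smul_apply, smul_eq_mul,
        traceExp_apply, Nat.mul_sub]
      have := Nat.mul_le_mul_left p (h i)
      omega
    · rfl

theorem traceExp_lt [Fact p.Prime] {a b : Fin n →₀ ℕ}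
    (h : MonomialOrder.lex.toSyn a < MonomialOrder.lex.toSyn b) :
    MonomialOrder.lex.toSyn (traceExp p a) < MonomialOrder.lex.toSyn (traceExp p b) := by
  have hp : 0 < p := (Fact.out : p.Prime).pos
  rw [MonomialOrder.lex_lt_iff, Finsupp.Lex.lt_iff] at h ⊢
  obtain ⟨i, h1, h2⟩ := h
  refine ⟨i, fun j hj => ?_, ?_⟩
  · have := h1 j hj
    simp only [ofLex_toLex, traceExp_apply] at this ⊢
    rw [this]
  · simp only [ofLex_toLex, traceExp_apply] at h2 ⊢
    have := Nat.mul_lt_mul_of_pos_left h2 hp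
    omega

/-- The trace of a polynomial whose leading monomial is not killed by the trace. -/
theorem degree_trace [Fact p.Prime] {F : MvPolynomial (Fin n) (ZMod p)} {e : Fin n →₀ ℕ}
    (hF : F ≠ 0) (hd : MonomialOrder.lex.degree F = traceExp p e) :
    trace p n F ≠ 0 ∧ MonomialOrder.lex.degree (trace p n F) = e := by
  have h1 : coeff e (trace p n F) ≠ 0 := by
    rw [coeff_trace, ← hd]
    exact MonomialOrder.lex.leadingCoeff_ne_zero_iff.2 hF
  have h0 : trace p n F ≠ 0 := fun h => h1 (by rw [h, coeff_zero])
  refine ⟨h0, MonomialOrder.lex.toSyn.injective (le_antisymm ?_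
    (MonomialOrder.lex.le_degree (mem_support_iff.2 h1)))⟩
  -- A larger leading exponent of the trace would give, by monotonicity of `traceExp`, a monomial of
  -- F above its leading one.
  by_contra! hlt
  have h2 := traceExp_lt (p := p) hlt
  rw [← hd] at h2
  have h3 := MonomialOrder.lex.coeff_eq_zero_of_lt h2
  rw [← coeff_trace] at h3
  exact h0 (MonomialOrder.lex.leadingCoeff_eq_zero_iff.1 h3)

variable {f : MvPolynomial (Fin n) (ZMod p)}
  {I J : Ideal (MvPolynomial (Fin n) (ZMod p))}

theorem IsCompatiblySplit.inf (hI : IsCompatiblySplit p f I) (hJ : IsCompatiblySplit p f J) :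
    IsCompatiblySplit p f (I ⊓ J) :=
  fun g hg => ⟨hI g hg.1, hJ g hg.2⟩

theorem IsCompatiblySplit.top : IsCompatiblySplit p f ⊤ := fun _ _ => trivial

variable [Fact p.Prime]

theorem IsCompatiblySplit.span_singleton : IsCompatiblySplit p f (Ideal.span {f}) := by
  intro g hg
  obtain ⟨k, rfl⟩ := Ideal.mem_span_singleton.1 hg
  rw [← mul_assoc, pow_sub_one_mul (Fact.out : p.Prime).ne_zero, trace_pow_mul]
  exact Ideal.mul_mem_right _ _ (Ideal.mem_span_singleton_self f)

theorem IsCompatiblySplit.sup (hI : IsCompatiblySplit p f I) (hJ : IsCompatiblySplit p f J) :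
    IsCompatiblySplit p f (I ⊔ J) := by
  intro g hg
  obtain ⟨a, ha, b, hb, rfl⟩ := Submodule.mem_sup.1 hg
  rw [mul_add, map_add]
  exact Submodule.add_mem_sup (hI a ha) (hJ b hb)

/-- Colon ideals of compatibly split ideals are compatibly split. -/
theorem IsCompatiblySplit.of_mem_iff (hI : IsCompatiblySplit p f I)
    {h : MvPolynomial (Fin n) (ZMod p)} (hJ : ∀ u, u ∈ J ↔ h * u ∈ I) :
    IsCompatiblySplit p f J := by
  intro g hg
  rw [hJ] at hg ⊢
  rw [← trace_pow_mul, mul_left_comm]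
  refine hI _ ?_
  rw [← mul_pow_sub_one (Fact.out : p.Prime).ne_zero h, mul_right_comm]
  exact I.mul_mem_right _ hg

/-- The argument for colon ideals applies with a multiplier h ∉ J that may depend on g; radicality
turns (h g) ^ k ∈ I into h g ∈ I. -/
theorem IsCompatiblySplit.of_mem_minimalPrimes (hI : IsCompatiblySplit p f I)
    (hrad : I.IsRadical) (hJ : J ∈ I.minimalPrimes) : IsCompatiblySplit p f J := by
  intro g hg
  obtain ⟨h, hh, k, hk⟩ := exists_mul_pow_mem_of_mem_minimalPrimes hJ hg
  have hJp := hJ.1.1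
  refine (hJp.mem_or_mem (hJ.1.2 ?_ : h * _ ∈ J)).resolve_left hh
  rw [← trace_pow_mul, mul_left_comm]
  refine hI _ ?_
  rw [← mul_pow_sub_one (Fact.out : p.Prime).ne_zero h, mul_right_comm]
  exact I.mul_mem_right _ (hrad ⟨k, hk⟩)

variable {c : ZMod p} {A : Finset (Fin n)}

/-- The exponent of a leading monomial may be divided by `p`, rounding up. -/
theorem IsCompatiblySplit.exists_degree (hI : IsCompatiblySplit p f I) (hf : f ≠ 0)
    (hlead : MonomialOrder.lex.degree f = squarefreeExp A)
    {u : MvPolynomial (Fin n) (ZMod p)} (hu : u ∈ I) (hu0 : u ≠ 0) {e : Fin n →₀ ℕ}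
    (he : MonomialOrder.lex.degree u ≤ p • e) :
    ∃ v ∈ I, v ≠ 0 ∧ MonomialOrder.lex.degree v = e := by
  have hp : 0 < p := (Fact.out : p.Prime).pos
  -- The first summand lifts deg u to p e. The missing p - 1 in each coordinate comes from f ^ (p -
  -- 1) on A and from the second summand off A, giving `traceExp p e` in total.
  let b : Fin n →₀ ℕ := p • e - MonomialOrder.lex.degree u + (p - 1) • squarefreeExp Aᶜ
  have hbu : monomial b 1 * u ≠ 0 := mul_ne_zero (by simp) hu0
  have hF : f ^ (p - 1) * (monomial b 1 * u) ≠ 0 := mul_ne_zero (pow_ne_zero _ hf) hbu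
  have hd : MonomialOrder.lex.degree (f ^ (p - 1) * (monomial b 1 * u)) = traceExp p e := by
    rw [MonomialOrder.lex.degree_mul (pow_ne_zero _ hf) hbu,
      degree_monomial_mul _ one_ne_zero hu0, MonomialOrder.lex.degree_pow, hlead]
    ext i
    have := he i
    by_cases hi : i ∈ A <;>
    simp [b, squarefreeExp_apply, hi] at this ⊢ <;> omega
  obtain ⟨h1, h2⟩ := degree_trace hF hd
  exact ⟨_, hI _ (I.mul_mem_left _ hu), h1, h2⟩

/-- The map d ↦ ⌈d / p⌉ preserves the support and takes exponents at most p ^ (k + 1) to exponents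
at most p ^ k, so iteration ends with all exponents at most 1. -/
theorem IsCompatiblySplit.exists_degree_squarefree (hI : IsCompatiblySplit p f I) (hf : f ≠ 0)
    (hlead : MonomialOrder.lex.degree f = squarefreeExp A)
    {u : MvPolynomial (Fin n) (ZMod p)} (hu : u ∈ I) (hu0 : u ≠ 0) :
    ∃ v ∈ I, v ≠ 0 ∧
      MonomialOrder.lex.degree v = squarefreeExp (MonomialOrder.lex.degree u).support := by
  have hp : 1 < p := (Fact.out : p.Prime).one_lt
  obtain ⟨k, hk⟩ : ∃ k, ∀ i, MonomialOrder.lex.degree u i ≤ p ^ k := by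
    refine ⟨∑ i, MonomialOrder.lex.degree u i, fun i => ?_⟩
    exact (Finset.single_le_sum (f := fun i => MonomialOrder.lex.degree u i)
      (fun _ _ => Nat.zero_le _) (Finset.mem_univ i)).trans (Nat.lt_pow_self hp).le
  induction k generalizing u with
  | zero =>
    refine ⟨u, hu, hu0, Finsupp.ext fun i => ?_⟩
    have h1 := hk i
    rw [squarefreeExp_apply]
    split_ifs with h
    · have h2 := Finsupp.mem_support_iff.1 h
      rw [pow_zero] at h1
      omega
    · exact Finsupp.notMem_support_iff.1 h
  | succ k ih =>
    let e : Fin n →₀ ℕ :=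
      Finsupp.equivFunOnFinite.symm fun i => (MonomialOrder.lex.degree u i + (p - 1)) / p
    have he : ∀ i, e i = (MonomialOrder.lex.degree u i + (p - 1)) / p := fun _ => rfl
    have hle : MonomialOrder.lex.degree u ≤ p • e := fun i => by
      have h1 := Nat.lt_mul_div_succ (MonomialOrder.lex.degree u i + (p - 1)) (zero_lt_one.trans hp)
      rw [mul_add, mul_one] at h1
      rw [Finsupp.smul_apply, smul_eq_mul, he]
      omega
    obtain ⟨v, hv, hv0, hd⟩ := hI.exists_degree hf hlead hu hu0 hle
    obtain ⟨w, hw, hw0, hwd⟩ := ih hv hv0 fun i => by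
      rw [hd, he]
      refine Nat.le_of_lt_succ ((Nat.div_lt_iff_lt_mul (zero_lt_one.trans hp)).2 ?_)
      have h1 := hk i
      rw [pow_succ] at h1
      rw [Nat.succ_mul]
      omega
    refine ⟨w, hw, hw0, ?_⟩
    rw [hwd, hd]
    congr 1
    ext i
    rw [Finsupp.mem_support_iff, Finsupp.mem_support_iff, he, Ne, Nat.div_eq_zero_iff]
    omega

theorem IsCompatiblySplit.hasSquarefreeLeads (hI : IsCompatiblySplit p f I) (hf : f ≠ 0)
    (hlead : MonomialOrder.lex.degree f = squarefreeExp A) :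
    HasSquarefreeLeads MonomialOrder.lex I := by
  intro u hu hu0
  obtain ⟨v, hv, hv0, hd⟩ := hI.exists_degree_squarefree hf hlead hu hu0
  have hc := MonomialOrder.lex.leadingCoeff_ne_zero_iff.2 hv0
  refine ⟨C (MonomialOrder.lex.leadingCoeff v)⁻¹ * v, I.mul_mem_left _ hv, ?_, ?_⟩
  · rw [MonomialOrder.Monic, MonomialOrder.leadingCoeff_mul, MonomialOrder.leadingCoeff_C,
      inv_mul_cancel₀ hc]
  · rw [← hd, MonomialOrder.degree_mul (by simpa using hv0) hv0, MonomialOrder.degree_C, zero_add]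

theorem Constructed.isCompatiblySplit (hf : f ≠ 0)
    (hlead : MonomialOrder.lex.degree f = squarefreeExp A) (hI : Constructed f I) :
    IsCompatiblySplit p f I := by
  induction hI with
  | hypersurface => exact .span_singleton
  | component _ hP ih =>
    exact ih.of_mem_minimalPrimes (ih.hasSquarefreeLeads hf hlead).isRadical hP
  | intersection _ _ h1 h2 => exact h1.sup h2
  | union _ _ h1 h2 => exact h1.inf h2

end Trace

/-! ### Reduction modulo almost all primes, and localization of ℤ. -/

section GenericReduction

open Filter hiding map

/-- J has finitely many generators, and the product of their multipliers works for all of J. -/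
theorem exists_forall_mul_mem {S : Type*} [CommRing S] [IsNoetherianRing S] (M : Submonoid S)
    {I J : Ideal S} (h : ∀ g ∈ J, ∃ s ∈ M, s * g ∈ I) : ∃ s ∈ M, ∀ g ∈ J, s * g ∈ I := by
  classical
  obtain ⟨G, rfl⟩ := IsNoetherian.noetherian J
  choose! s hsM hs using h
  refine ⟨∏ g ∈ G, s g, M.prod_mem fun g hg => hsM g (Ideal.subset_span hg), fun g hg => ?_⟩
  induction hg using Submodule.span_induction with
  | mem g hg =>
    rw [← Finset.prod_erase_mul _ _ hg, mul_assoc]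
    exact I.mul_mem_left _ (hs g (Ideal.subset_span hg))
  | zero => simp
  | add a b _ _ ha hb => rw [mul_add]; exact I.add_mem ha hb
  | smul r a _ ha => rw [smul_eq_mul, mul_left_comm]; exact I.mul_mem_left _ ha

/-- The torsion of `A ⧸ I` is annihilated by a single nonzero integer. -/
theorem exists_forall_C_mul_mem {n : ℕ} (I : Ideal (MvPolynomial (Fin n) ℤ)) :
    ∃ d : ℤ, d ≠ 0 ∧ ∀ g, ∀ k : ℤ, k ≠ 0 → C k * g ∈ I → C d * g ∈ I := by
  let M : Submonoid (MvPolynomial (Fin n) ℤ) := (nonZeroDivisors ℤ).map C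
  have hM : ∀ k : ℤ, k ≠ 0 → C k ∈ M := fun k hk => ⟨k, mem_nonZeroDivisors_of_ne_zero hk, rfl⟩
  let T : Ideal (MvPolynomial (Fin n) ℤ) :=
    { carrier := {g | ∃ s ∈ M, s * g ∈ I}
      zero_mem' := ⟨1, M.one_mem, by simp⟩
      add_mem' := by
        rintro a b ⟨s, hs, ha⟩ ⟨t, ht, hb⟩
        refine ⟨s * t, M.mul_mem hs ht, ?_⟩
        rw [mul_add, mul_right_comm, mul_assoc s t b]
        exact I.add_mem (I.mul_mem_right _ ha) (I.mul_mem_left _ hb)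
      smul_mem' := by
        rintro r a ⟨s, hs, ha⟩
        refine ⟨s, hs, ?_⟩
        rw [smul_eq_mul, mul_left_comm]
        exact I.mul_mem_left _ ha }
  obtain ⟨_, ⟨d, hd, rfl⟩, h⟩ := exists_forall_mul_mem M (I := I) (J := T) fun g hg => hg
  exact ⟨d, nonZeroDivisors.ne_zero hd, fun g k hk hg => h g ⟨C k, hM k hk, hg⟩⟩

theorem mem_of_isCoprime {n : ℕ} {I : Ideal (MvPolynomial (Fin n) ℤ)} {a b : ℤ}
    (hab : IsCoprime a b) {g : MvPolynomial (Fin n) ℤ} (ha : C a * g ∈ I) (hb : C b * g ∈ I) :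
    g ∈ I := by
  obtain ⟨r, s, hrs⟩ := hab
  have h1 : g = C r * (C a * g) + C s * (C b * g) := by
    rw [← mul_assoc, ← mul_assoc, ← C_mul, ← C_mul, ← add_mul, ← C_add, hrs, C_1, one_mul]
  rw [h1]
  exact I.add_mem (I.mul_mem_left _ ha) (I.mul_mem_left _ hb)

theorem eventually_not_dvd {d : ℤ} (hd : d ≠ 0) : ∀ᶠ p : ℕ in atTop, ¬ (p : ℤ) ∣ d := by
  filter_upwards [eventually_gt_atTop d.natAbs] with p hp h
  exact absurd (Nat.le_of_dvd (Int.natAbs_pos.2 hd) (Int.natCast_dvd.1 h)) (not_le.2 hp)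

/-- A prime p not dividing the annihilator d of the torsion is coprime to d, so p g ∈ I and d g ∈ I
give g ∈ I. -/
theorem eventually_mem_of_C_mul_mem {n : ℕ} (I : Ideal (MvPolynomial (Fin n) ℤ)) :
    ∀ᶠ p : ℕ in atTop, ∀ _ : Fact p.Prime, ∀ g, C (p : ℤ) * g ∈ I → g ∈ I := by
  obtain ⟨d, hd, h⟩ := exists_forall_C_mul_mem I
  filter_upwards [eventually_not_dvd hd] with p hp hpp g hg
  have hpr := Nat.prime_iff_prime_int.1 hpp.out
  exact mem_of_isCoprime ((hpr.irreducible.coprime_iff_not_dvd).2 hp) hg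
    (h g p hpr.ne_zero hg)

section Reduction

variable {p n : ℕ}

theorem mem_baseChange_zmod {I : Ideal (MvPolynomial (Fin n) ℤ)}
    {u : MvPolynomial (Fin n) (ZMod p)} :
    u ∈ baseChange (Int.castRingHom (ZMod p)) I ↔
      ∃ g ∈ I, map (Int.castRingHom (ZMod p)) g = u :=
  Ideal.mem_map_iff_of_surjective _ (map_surjective _ (ZMod.ringHom_surjective _))

theorem exists_eq_add_of_map_eq {g h : MvPolynomial (Fin n) ℤ}
    (hgh : map (Int.castRingHom (ZMod p)) g = map (Int.castRingHom (ZMod p)) h) :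
    ∃ w, g = h + C (p : ℤ) * w := by
  have h1 : map (Int.castRingHom (ZMod p)) (g - h) = 0 := by rw [map_sub, hgh, sub_self]
  obtain ⟨w, hw⟩ := (C_dvd_iff_zmod p _).2 h1
  exact ⟨w, by rw [← hw, add_sub_cancel]⟩

theorem map_C_natCast_mul (w : MvPolynomial (Fin n) ℤ) :
    map (Int.castRingHom (ZMod p)) (C (p : ℤ) * w) = 0 :=
  (C_dvd_iff_zmod p _).1 (Dvd.intro _ rfl)

/-- Reduction modulo `p` commutes with an intersection if `p` is a nonzerodivisor modulo the
sum. -/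
theorem baseChange_zmod_inf {I J : Ideal (MvPolynomial (Fin n) ℤ)}
    (h : ∀ g, C (p : ℤ) * g ∈ I ⊔ J → g ∈ I ⊔ J) :
    baseChange (Int.castRingHom (ZMod p)) (I ⊓ J) =
      baseChange (Int.castRingHom (ZMod p)) I ⊓ baseChange (Int.castRingHom (ZMod p)) J := by
  refine le_antisymm (Ideal.map_inf_le _) fun u ⟨hI, hJ⟩ => ?_
  obtain ⟨a, ha, rfl⟩ := mem_baseChange_zmod.1 hI
  obtain ⟨b, hb, hab⟩ := mem_baseChange_zmod.1 hJ
  obtain ⟨w, hw⟩ := exists_eq_add_of_map_eq hab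
  have hwmem : C (p : ℤ) * w ∈ I ⊔ J := by
    rw [← sub_eq_iff_eq_add'.2 hw]
    exact (I ⊔ J).sub_mem (Ideal.mem_sup_right hb) (Ideal.mem_sup_left ha)
  -- The lifts satisfy a = b + p w. Writing w = i + j with i ∈ I and j ∈ J, the common lift is a
  -- corrected by a multiple of p i; the sign is governed by the identity below.
  obtain ⟨i, hi, j, hj, rfl⟩ := Submodule.mem_sup.1 (h w hwmem)
  refine mem_baseChange_zmod.2 ⟨a + C (p : ℤ) * i, ⟨I.add_mem ha (I.mul_mem_left _ hi), ?_⟩, ?_⟩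
  · have h1 : a + C (p : ℤ) * i = b - C (p : ℤ) * j := by rw [hw]; ring
    rw [h1]
    exact J.sub_mem hb (J.mul_mem_left _ hj)
  · rw [map_add, map_C_natCast_mul, add_zero]

/-- Reduction modulo `p` commutes with a colon ideal `J = (I : h)` if `p` is a nonzerodivisor modulo
`I + (h)`. -/
theorem mem_baseChange_zmod_of_colon {I J : Ideal (MvPolynomial (Fin n) ℤ)}
    {h : MvPolynomial (Fin n) ℤ} (hJ : ∀ u, u ∈ J ↔ h * u ∈ I)
    (hp : ∀ g, C (p : ℤ) * g ∈ I ⊔ Ideal.span {h} → g ∈ I ⊔ Ideal.span {h})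
    (u : MvPolynomial (Fin n) (ZMod p)) :
    u ∈ baseChange (Int.castRingHom (ZMod p)) J ↔
      map (Int.castRingHom (ZMod p)) h * u ∈ baseChange (Int.castRingHom (ZMod p)) I := by
  constructor
  · intro hu
    obtain ⟨g, hg, rfl⟩ := mem_baseChange_zmod.1 hu
    exact mem_baseChange_zmod.2 ⟨h * g, (hJ g).1 hg, map_mul _ _ _⟩
  · intro hu
    obtain ⟨g, rfl⟩ := map_surjective (σ := Fin n) _
      (ZMod.ringHom_surjective (Int.castRingHom (ZMod p))) u
    rw [← map_mul] at hu
    obtain ⟨a, ha, hag⟩ := mem_baseChange_zmod.1 hu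
    obtain ⟨w, hw⟩ := exists_eq_add_of_map_eq hag
    have hwmem : C (p : ℤ) * w ∈ I ⊔ Ideal.span {h} := by
      rw [← sub_eq_iff_eq_add'.2 hw]
      exact Ideal.sub_mem _ (Ideal.mem_sup_left ha)
        (Ideal.mem_sup_right (Ideal.mul_mem_right _ _ (Ideal.mem_span_singleton_self h)))
    obtain ⟨i, hi, j, hj, rfl⟩ := Submodule.mem_sup.1 (hp w hwmem)
    obtain ⟨k, rfl⟩ := Ideal.mem_span_singleton.1 hj
    refine mem_baseChange_zmod.2 ⟨g + C (p : ℤ) * k, (hJ _).2 ?_, ?_⟩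
    · have h1 : h * (g + C (p : ℤ) * k) = a - C (p : ℤ) * i := by rw [hw]; ring
      rw [h1]
      exact I.sub_mem ha (I.mul_mem_left _ hi)
    · rw [map_add, map_C_natCast_mul, add_zero]

end Reduction

section Degree

variable {σ R S : Type*} [CommRing R] [CommRing S] {m : MonomialOrder σ}

theorem degree_map_of_ne_zero (ρ : R →+* S) {g : MvPolynomial σ R}
    (h : ρ (m.leadingCoeff g) ≠ 0) : m.degree (map ρ g) = m.degree g := by
  refine m.toSyn.injective (le_antisymm ?_ (m.le_degree ?_))
  · rw [m.degree_le_iff]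
    exact fun b hb => m.le_degree (support_map_subset ρ g hb)
  · rwa [mem_support_iff, coeff_map]

theorem leadingCoeff_map_of_ne_zero (ρ : R →+* S) {g : MvPolynomial σ R}
    (h : ρ (m.leadingCoeff g) ≠ 0) : m.leadingCoeff (map ρ g) = ρ (m.leadingCoeff g) := by
  rw [MonomialOrder.leadingCoeff, degree_map_of_ne_zero ρ h, coeff_map, MonomialOrder.leadingCoeff]

end Degree

/-- Dickson's lemma: the leading monomials of an ideal are generated by finitely many. -/
theorem exists_finite_degree_le {n : ℕ} {R : Type*} [CommRing R] (m : MonomialOrder (Fin n))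
    (I : Ideal (MvPolynomial (Fin n) R)) :
    ∃ G : Set (MvPolynomial (Fin n) R), G.Finite ∧ (∀ g ∈ G, g ∈ I ∧ g ≠ 0) ∧
      ∀ u ∈ I, u ≠ 0 → ∃ g ∈ G, m.degree g ≤ m.degree u := by
  let P : (Fin n →₀ ℕ) → Prop := fun e => ∃ u ∈ I, u ≠ 0 ∧ m.degree u = e
  have hfin : {e | Minimal P e}.Finite :=
    WellQuasiOrderedLE.finite_of_isAntichain (setOfPred_minimal_antichain P)
  choose! g hgI hg0 hgd using fun e (he : P e) => he
  refine ⟨g '' {e | Minimal P e}, hfin.image g, ?_, fun u hu hu0 => ?_⟩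
  · rintro _ ⟨e, he, rfl⟩
    exact ⟨hgI e he.prop, hg0 e he.prop⟩
  · obtain ⟨e, hle, he⟩ := exists_minimal_le_of_wellFoundedLT P (m.degree u) ⟨u, hu, hu0, rfl⟩
    exact ⟨g e, ⟨e, he, rfl⟩, (hgd e he.prop).trans_le hle⟩

/-- For large p no leading coefficient of a finite set G generating the leading monomials is
divisible by p. If p divides the leading coefficient of a lift v of u, cross-multiplying with some g
∈ G cancels the leading term, while modulo p it only scales u by a unit. By well-foundedness some
lift of a unit multiple of u keeps its degree. -/
theorem eventually_exists_degree_eq {n : ℕ} (m : MonomialOrder (Fin n))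
    (I : Ideal (MvPolynomial (Fin n) ℤ)) :
    ∀ᶠ p : ℕ in atTop, ∀ _ : Fact p.Prime, ∀ u ∈ baseChange (Int.castRingHom (ZMod p)) I,
      u ≠ 0 → ∃ v ∈ I, v ≠ 0 ∧ m.degree v = m.degree u := by
  obtain ⟨G, hfin, hG, hle⟩ := exists_finite_degree_le m I
  have h1 : ∀ᶠ p : ℕ in atTop, ∀ g ∈ G, ¬ (p : ℤ) ∣ m.leadingCoeff g :=
    (eventually_all_finite hfin).2 fun g hg =>
      eventually_not_dvd (m.leadingCoeff_ne_zero_iff.2 (hG g hg).2)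
  filter_upwards [h1] with p hp hpp u hu
  obtain ⟨v, hv, rfl⟩ := mem_baseChange_zmod.1 hu
  intro hne
  clear hu
  have hmap : ∀ k : ℤ, (Int.castRingHom (ZMod p)) k = 0 ↔ (p : ℤ) ∣ k := fun k => by
    rw [eq_intCast, ZMod.intCast_zmod_eq_zero_iff_dvd]
  induction hd : m.toSyn (m.degree v) using WellFoundedLT.induction generalizing v with
  | ind d ih =>
    have hv0 : v ≠ 0 := by rintro rfl; simp at hne
    by_cases hdvd : (p : ℤ) ∣ m.leadingCoeff v
    · obtain ⟨g, hg, hgle⟩ := hle v hv hv0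
      have hg0 := (hG g hg).2
      have hlg := m.leadingCoeff_ne_zero_iff.2 hg0
      have hlv := m.leadingCoeff_ne_zero_iff.2 hv0
      let w := C (m.leadingCoeff g) * v -
        monomial (m.degree v - m.degree g) (m.leadingCoeff v) * g
      have hwI : w ∈ I := I.sub_mem (I.mul_mem_left _ hv) (I.mul_mem_left _ (hG g hg).1)
      have hc0 : C (Int.castRingHom (ZMod p) (m.leadingCoeff g)) ≠
          (0 : MvPolynomial (Fin n) (ZMod p)) := by
        rw [Ne, C_eq_zero, hmap]
        exact hp g hg
      have hwmap : map (Int.castRingHom (ZMod p)) w =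
          C (Int.castRingHom (ZMod p) (m.leadingCoeff g)) * map (Int.castRingHom (ZMod p)) v := by
        simp only [w, map_sub, map_mul, map_C, map_monomial, (hmap _).2 hdvd, monomial_zero,
          zero_mul, sub_zero]
      have hwne : map (Int.castRingHom (ZMod p)) w ≠ 0 := by
        rw [hwmap]
        exact mul_ne_zero hc0 hne
      have hw0 : w ≠ 0 := by
        intro h
        rw [h, map_zero] at hwne
        exact hwne rfl
      have hdC : m.degree (C (m.leadingCoeff g) * v) = m.degree v := by
        rw [m.degree_mul (by simpa using hg0) hv0, m.degree_C, zero_add]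
      have hdw : m.degree (monomial (m.degree v - m.degree g) (m.leadingCoeff v) * g) =
          m.degree v := by
        rw [degree_monomial_mul m hlv hg0, tsub_add_cancel_of_le hgle]
      have hlc : m.leadingCoeff (monomial (m.degree v - m.degree g) (m.leadingCoeff v) * g) =
          m.leadingCoeff (C (m.leadingCoeff g) * v) := by
        rw [m.leadingCoeff_mul, m.leadingCoeff_mul, m.leadingCoeff_monomial, m.leadingCoeff_C,
          mul_comm]
      have hlt : m.toSyn (m.degree w) < m.toSyn (m.degree v) := by
        rw [← hdC]
        refine degree_sub_lt_of_coeff_eq m (by rw [hdC, hdw]) ?_ hw0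
        rw [MonomialOrder.leadingCoeff, hdw] at hlc
        rwa [hdC]
      obtain ⟨x, hx, hx0, hxd⟩ := ih _ (hd ▸ hlt) w hwI hwne rfl
      refine ⟨x, hx, hx0, ?_⟩
      rw [hxd, hwmap, m.degree_mul hc0 hne, m.degree_C, zero_add]
    · exact ⟨v, hv, hv0, (degree_map_of_ne_zero _ fun h => hdvd ((hmap _).1 h)).symm⟩

section Localization

variable {n : ℕ} {R : Type*} [CommRing R] [Algebra ℤ R] (M : Submonoid ℤ) [IsLocalization M R]

attribute [local instance] algebraMvPolynomial

include M in
theorem map_mem_baseChange_iff {I : Ideal (MvPolynomial (Fin n) ℤ)}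
    {g : MvPolynomial (Fin n) ℤ} :
    map (algebraMap ℤ R) g ∈ baseChange (algebraMap ℤ R) I ↔ ∃ s ∈ M, C s * g ∈ I := by
  have h := IsLocalization.algebraMap_mem_map_algebraMap_iff (S := MvPolynomial (Fin n) R)
    (M.map (C (σ := Fin n))) I g
  refine h.trans ⟨?_, ?_⟩
  · rintro ⟨_, ⟨s, hs, rfl⟩, h⟩
    exact ⟨s, hs, h⟩
  · rintro ⟨s, hs, h⟩
    exact ⟨C s, ⟨s, hs, rfl⟩, h⟩

variable (R) in
include M in
theorem baseChange_inf (I J : Ideal (MvPolynomial (Fin n) ℤ)) :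
    baseChange (algebraMap ℤ R) (I ⊓ J) =
      baseChange (algebraMap ℤ R) I ⊓ baseChange (algebraMap ℤ R) J :=
  IsLocalization.map_inf (S := MvPolynomial (Fin n) R) (M.map (C (σ := Fin n))) I J

include M in
theorem baseChange_comap (J : Ideal (MvPolynomial (Fin n) R)) :
    baseChange (algebraMap ℤ R) (J.comap (map (algebraMap ℤ R))) = J :=
  IsLocalization.map_under (M.map (C (σ := Fin n))) (MvPolynomial (Fin n) R) J

include M in
theorem exists_mul_eq_map_of_mem_baseChange {I : Ideal (MvPolynomial (Fin n) ℤ)}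
    {u : MvPolynomial (Fin n) R} (hu : u ∈ baseChange (algebraMap ℤ R) I) :
    ∃ s ∈ M, ∃ g ∈ I, C (algebraMap ℤ R s) * u = map (algebraMap ℤ R) g := by
  obtain ⟨⟨⟨g, hg⟩, ⟨_, s, hs, rfl⟩⟩, h⟩ := (IsLocalization.mem_map_algebraMap_iff
    (S := MvPolynomial (Fin n) R) (M.map (C (σ := Fin n)))).1 hu
  refine ⟨s, hs, g, hg, ?_⟩
  rw [mul_comm, ← map_C]
  exact h

variable [IsDomain R] {m : MonomialOrder (Fin n)}

include M in
-- Clearing denominators multiplies by a nonzero constant, which does not affect the degree.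
theorem exists_degree_eq_of_mem_baseChange (hR : Function.Injective (algebraMap ℤ R))
    {I : Ideal (MvPolynomial (Fin n) ℤ)} {u : MvPolynomial (Fin n) R}
    (hu : u ∈ baseChange (algebraMap ℤ R) I) (hu0 : u ≠ 0) :
    ∃ g ∈ I, g ≠ 0 ∧ m.degree g = m.degree u := by
  obtain ⟨s, hs, g, hg, h⟩ := exists_mul_eq_map_of_mem_baseChange M hu
  have hs0 : (C (algebraMap ℤ R s) : MvPolynomial (Fin n) R) ≠ 0 :=
    C_ne_zero.2 (IsLocalization.map_units R ⟨s, hs⟩).ne_zero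
  have hg0 : g ≠ 0 := by
    rintro rfl
    rw [map_zero] at h
    exact mul_ne_zero hs0 hu0 h
  refine ⟨g, hg, hg0, ?_⟩
  rw [← degree_map_of_ne_zero (algebraMap ℤ R)
    ((map_ne_zero_iff _ hR).2 (m.leadingCoeff_ne_zero_iff.2 hg0)), ← h, m.degree_mul hs0 hu0,
    m.degree_C, zero_add]

include M in
theorem hasSquarefreeLeads_baseChange (hR : Function.Injective (algebraMap ℤ R))
    {I : Ideal (MvPolynomial (Fin n) ℤ)}
    (h : ∀ u ∈ I, u ≠ 0 → ∃ v ∈ I, m.degree v = squarefreeExp (m.degree u).support ∧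
      IsUnit (algebraMap ℤ R (m.leadingCoeff v))) :
    HasSquarefreeLeads m (baseChange (algebraMap ℤ R) I) := by
  intro u hu hu0
  obtain ⟨g, hg, hg0, hgd⟩ := exists_degree_eq_of_mem_baseChange (m := m) M hR hu hu0
  obtain ⟨v, hv, hvd, hvu⟩ := h g hg hg0
  obtain ⟨a, ha⟩ := hvu.exists_left_inv
  have hlc := leadingCoeff_map_of_ne_zero (algebraMap ℤ R) hvu.ne_zero
  have hmon : m.Monic (C a * map (algebraMap ℤ R) v) := by
    rw [MonomialOrder.Monic, m.leadingCoeff_mul, m.leadingCoeff_C, hlc, ha]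
  refine ⟨_, Ideal.mul_mem_left _ _ (Ideal.mem_map_of_mem _ hv), hmon, ?_⟩
  rw [m.degree_mul' hmon.ne_zero, m.degree_C, zero_add, degree_map_of_ne_zero _ hvu.ne_zero, hvd,
    hgd]

end Localization

end GenericReduction

/-! ### Squarefree leads over ℚ, and finiteness of the rational family. -/

section Rational

open Filter hiding map

theorem intCast_rat_injective : Function.Injective (algebraMap ℤ ℚ) :=
  IsFractionRing.injective ℤ ℚ

theorem exists_prime_of_eventually {P : ℕ → Prop} (h : ∀ᶠ p in atTop, P p) :
    ∃ p, p.Prime ∧ P p := by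
  obtain ⟨B, hB⟩ := eventually_atTop.1 h
  obtain ⟨p, hBp, hp⟩ := Nat.exists_infinite_primes B
  exact ⟨p, hp, hB p hBp⟩

variable {n : ℕ}

/-- If the reductions of an ideal modulo almost all primes have squarefree leading monomials, then
so does the ideal over `ℚ`. -/
theorem hasSquarefreeLeads_rat {I : Ideal (MvPolynomial (Fin n) ℤ)} {m : MonomialOrder (Fin n)}
    (h : ∀ᶠ p : ℕ in atTop, ∀ _ : Fact p.Prime,
      HasSquarefreeLeads m (baseChange (Int.castRingHom (ZMod p)) I)) :
    HasSquarefreeLeads m (baseChange (algebraMap ℤ ℚ) I) := by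
  refine hasSquarefreeLeads_baseChange (nonZeroDivisors ℤ) intCast_rat_injective fun u hu hu0 => ?_
  have hlc := m.leadingCoeff_ne_zero_iff.2 hu0
  -- One large prime suffices for a given u: reduction keeps deg u, the squarefree lead exists
  -- modulo p, and its exponent is attained by an element of I.
  obtain ⟨p, hp, h1, h2, h3⟩ := exists_prime_of_eventually
    (h.and ((eventually_exists_degree_eq m I).and (eventually_not_dvd hlc)))
  have := Fact.mk hp
  have hlcp : Int.castRingHom (ZMod p) (m.leadingCoeff u) ≠ 0 := by
    rwa [eq_intCast, Ne, ZMod.intCast_zmod_eq_zero_iff_dvd]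
  have hne : map (Int.castRingHom (ZMod p)) u ≠ 0 := by
    rw [← m.leadingCoeff_ne_zero_iff, leadingCoeff_map_of_ne_zero _ hlcp]
    exact hlcp
  obtain ⟨v, hv, hvm, hvd⟩ := h1 this _ (Ideal.mem_map_of_mem _ hu) hne
  obtain ⟨w, hw, hw0, hwd⟩ := h2 this v hv hvm.ne_zero
  refine ⟨w, hw, by rw [hwd, hvd, degree_map_of_ne_zero _ hlcp], ?_⟩
  rw [isUnit_iff_ne_zero, map_ne_zero_iff _ intCast_rat_injective]
  exact m.leadingCoeff_ne_zero_iff.2 hw0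

theorem exists_C_mul_mem_of_isRadical {I : Ideal (MvPolynomial (Fin n) ℤ)}
    (hI : (baseChange (algebraMap ℤ ℚ) I).IsRadical) {g : MvPolynomial (Fin n) ℤ} {k : ℕ}
    (hg : g ^ k ∈ I) : ∃ d : ℤ, d ≠ 0 ∧ C d * g ∈ I := by
  have h1 : map (algebraMap ℤ ℚ) g ∈ baseChange (algebraMap ℤ ℚ) I :=
    hI ⟨k, by rw [← map_pow]; exact Ideal.mem_map_of_mem _ hg⟩
  obtain ⟨d, hd, h⟩ := (map_mem_baseChange_iff (nonZeroDivisors ℤ)).1 h1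
  exact ⟨d, nonZeroDivisors.ne_zero hd, h⟩

/-- A minimal prime over a generically reduced ideal is a colon ideal, unless it contains a nonzero
integer. -/
theorem exists_colon_of_mem_minimalPrimes {I P : Ideal (MvPolynomial (Fin n) ℤ)}
    (hI : (baseChange (algebraMap ℤ ℚ) I).IsRadical) (hP : P ∈ I.minimalPrimes)
    (hPZ : ∀ d : ℤ, d ≠ 0 → C d ∉ P) : ∃ h, ∀ u, u ∈ P ↔ h * u ∈ I := by
  have hPp := hP.1.1
  -- Each g ∈ P has a multiplier outside P that carries it into I; the noetherian property makes it
  -- uniform. Conversely h u ∈ I ≤ P with h ∉ P forces u ∈ P.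
  obtain ⟨h, hh, hle⟩ := exists_forall_mul_mem P.primeCompl (I := I) (J := P) fun g hg => by
    obtain ⟨h, hh, k, hk⟩ := exists_mul_pow_mem_of_mem_minimalPrimes hP hg
    obtain ⟨d, hd, hdg⟩ := exists_C_mul_mem_of_isRadical hI hk
    exact ⟨C d * h, P.primeCompl.mul_mem (hPZ d hd) hh, by rwa [mul_assoc]⟩
  exact ⟨h, fun u => ⟨hle u, fun hu => (hPp.mem_or_mem (hP.1.2 hu)).resolve_left hh⟩⟩

variable {f : MvPolynomial (Fin n) ℤ} {A : Finset (Fin n)}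

theorem map_zmod_ne_zero {p : ℕ} {m : MonomialOrder (Fin n)}
    (hp : ¬ (p : ℤ) ∣ m.leadingCoeff f) :
    map (Int.castRingHom (ZMod p)) f ≠ 0 ∧
      m.degree (map (Int.castRingHom (ZMod p)) f) = m.degree f := by
  have hlcp : Int.castRingHom (ZMod p) (m.leadingCoeff f) ≠ 0 := by
    rwa [eq_intCast, Ne, ZMod.intCast_zmod_eq_zero_iff_dvd]
  refine ⟨?_, degree_map_of_ne_zero _ hlcp⟩
  rw [← m.leadingCoeff_ne_zero_iff, leadingCoeff_map_of_ne_zero _ hlcp]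
  exact hlcp

/-- If the reductions of an ideal modulo almost all primes are compatibly split, then the ideal has
squarefree leading monomials over `ℚ`. -/
theorem hasSquarefreeLeads_rat_of_isCompatiblySplit (hf : f ≠ 0)
    (hlead : MonomialOrder.lex.degree f = squarefreeExp A) {I : Ideal (MvPolynomial (Fin n) ℤ)}
    (h : ∀ᶠ p : ℕ in atTop, ∀ _ : Fact p.Prime,
      IsCompatiblySplit p (map (Int.castRingHom (ZMod p)) f)
        (baseChange (Int.castRingHom (ZMod p)) I)) :
    HasSquarefreeLeads MonomialOrder.lex (baseChange (algebraMap ℤ ℚ) I) := by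
  refine hasSquarefreeLeads_rat ?_
  filter_upwards [h, eventually_not_dvd (MonomialOrder.lex.leadingCoeff_ne_zero_iff.2 hf)]
    with p h1 h2 hp
  obtain ⟨h3, h4⟩ := map_zmod_ne_zero h2
  exact (h1 hp).hasSquarefreeLeads h3 (h4.trans hlead)

/-- The induction feeds on itself at components: split reductions of I make I radical over ℚ, hence
P is a colon ideal of I, and forming it commutes with reduction modulo large p. A component
containing a nonzero integer reduces to the unit ideal for large p. -/
theorem Constructed.eventually_isCompatiblySplit (hf : f ≠ 0)
    (hlead : MonomialOrder.lex.degree f = squarefreeExp A) {I : Ideal (MvPolynomial (Fin n) ℤ)}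
    (hI : Constructed f I) :
    ∀ᶠ p : ℕ in atTop, ∀ _ : Fact p.Prime,
      IsCompatiblySplit p (map (Int.castRingHom (ZMod p)) f)
        (baseChange (Int.castRingHom (ZMod p)) I) := by
  induction hI with
  | hypersurface =>
    refine Eventually.of_forall fun p hp => ?_
    rw [baseChange, Ideal.map_span, Set.image_singleton]
    exact .span_singleton
  | intersection _ _ h1 h2 =>
    filter_upwards [h1, h2] with p h1 h2 hp
    rw [baseChange, Ideal.map_sup]
    exact (h1 hp).sup (h2 hp)
  | @union I J _ _ h1 h2 =>
    filter_upwards [h1, h2, eventually_mem_of_C_mul_mem (I ⊔ J)] with p h1 h2 h3 hp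
    rw [baseChange_zmod_inf (h3 hp)]
    exact (h1 hp).inf (h2 hp)
  | @component I P _ hP ih =>
    by_cases hPZ : ∀ d : ℤ, d ≠ 0 → C d ∉ P
    · obtain ⟨h, hh⟩ := exists_colon_of_mem_minimalPrimes
        (hasSquarefreeLeads_rat_of_isCompatiblySplit hf hlead ih).isRadical hP hPZ
      filter_upwards [ih, eventually_mem_of_C_mul_mem (I ⊔ Ideal.span {h})] with p h1 h2 hp
      exact (h1 hp).of_mem_iff (mem_baseChange_zmod_of_colon hh (h2 hp))
    · push Not at hPZ
      obtain ⟨d, hd, hdP⟩ := hPZ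
      filter_upwards [eventually_not_dvd hd] with p hpd hp
      have h1 : baseChange (Int.castRingHom (ZMod p)) P = ⊤ := by
        refine Ideal.eq_top_of_isUnit_mem _ (Ideal.mem_map_of_mem _ hdP) ?_
        rw [map_C]
        refine IsUnit.map C (isUnit_iff_ne_zero.2 ?_)
        rwa [eq_intCast, Ne, ZMod.intCast_zmod_eq_zero_iff_dvd]
      rw [h1]
      exact .top

theorem Constructed.hasSquarefreeLeads_rat (hf : f ≠ 0)
    (hlead : MonomialOrder.lex.degree f = squarefreeExp A) {I : Ideal (MvPolynomial (Fin n) ℤ)}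
    (hI : Constructed f I) :
    HasSquarefreeLeads MonomialOrder.lex (baseChange (algebraMap ℤ ℚ) I) :=
  hasSquarefreeLeads_rat_of_isCompatiblySplit hf hlead (hI.eventually_isCompatiblySplit hf hlead)

theorem hasSquarefreeLeads_of_mem_rationalFamily (hf : f ≠ 0)
    (hlead : MonomialOrder.lex.degree f = squarefreeExp A) {J : Ideal (MvPolynomial (Fin n) ℚ)}
    (hJ : J ∈ rationalFamily f) : HasSquarefreeLeads MonomialOrder.lex J := by
  obtain ⟨I, hI, rfl⟩ := hJ
  exact Constructed.hasSquarefreeLeads_rat hf hlead hI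

theorem inf_mem_rationalFamily {J K : Ideal (MvPolynomial (Fin n) ℚ)}
    (hJ : J ∈ rationalFamily f) (hK : K ∈ rationalFamily f) : J ⊓ K ∈ rationalFamily f := by
  obtain ⟨I, hI, rfl⟩ := hJ
  obtain ⟨I', hI', rfl⟩ := hK
  exact ⟨I ⊓ I', hI.union hI', baseChange_inf ℚ (nonZeroDivisors ℤ) I I'⟩

theorem finite_rationalFamily (hf : f ≠ 0)
    (hlead : MonomialOrder.lex.degree f = squarefreeExp A) : (rationalFamily f).Finite :=
  finite_of_hasSquarefreeLeads (fun _ => hasSquarefreeLeads_of_mem_rationalFamily hf hlead)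
    fun _ hI _ hJ => inf_mem_rationalFamily hI hJ

end Rational

/-! ### One integer N that works for all constructed schemes. -/

section GoodModulus

open Filter hiding map

variable {n : ℕ}

/-- The ideal of the closure in affine space over `ℤ` of a closed subscheme over `ℚ`. -/
def flatClosure (J : Ideal (MvPolynomial (Fin n) ℚ)) : Ideal (MvPolynomial (Fin n) ℤ) :=
  J.comap (map (algebraMap ℤ ℚ))

theorem mem_flatClosure_baseChange {I : Ideal (MvPolynomial (Fin n) ℤ)}
    {g : MvPolynomial (Fin n) ℤ} :
    g ∈ flatClosure (baseChange (algebraMap ℤ ℚ) I) ↔ ∃ k : ℤ, k ≠ 0 ∧ C k * g ∈ I := by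
  rw [flatClosure, Ideal.mem_comap, map_mem_baseChange_iff (nonZeroDivisors ℤ)]
  simp only [mem_nonZeroDivisors_iff_ne_zero]

theorem le_flatClosure (I : Ideal (MvPolynomial (Fin n) ℤ)) :
    I ≤ flatClosure (baseChange (algebraMap ℤ ℚ) I) :=
  Ideal.le_comap_map

/-- Both ideals have the same extension to ℚ, so they differ by torsion, which a single integer
kills. -/
theorem exists_forall_C_mul_mem_sup (J K : Ideal (MvPolynomial (Fin n) ℚ)) :
    ∃ d : ℤ, d ≠ 0 ∧ ∀ g ∈ flatClosure (J ⊔ K),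
      C d * g ∈ flatClosure J ⊔ flatClosure K := by
  have h1 : ∀ L : Ideal (MvPolynomial (Fin n) ℚ),
      L ≤ baseChange (algebraMap ℤ ℚ) (flatClosure L) := fun L =>
    (baseChange_comap (nonZeroDivisors ℤ) L).ge
  obtain ⟨d, hd, h⟩ := exists_forall_C_mul_mem (flatClosure J ⊔ flatClosure K)
  refine ⟨d, hd, fun g hg => ?_⟩
  have h2 : g ∈ flatClosure
      (baseChange (algebraMap ℤ ℚ) (flatClosure J ⊔ flatClosure K)) := by
    refine Ideal.comap_mono ?_ hg
    rw [baseChange, Ideal.map_sup]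
    exact sup_le_sup (h1 J) (h1 K)
  obtain ⟨k, hk, hkg⟩ := mem_flatClosure_baseChange.1 h2
  exact h g k hk hkg

theorem baseChange_zmod_flatClosure {p : ℕ} [Fact p.Prime]
    {I : Ideal (MvPolynomial (Fin n) ℤ)}
    (h : ∀ g ∈ flatClosure (baseChange (algebraMap ℤ ℚ) I),
      ∃ k : ℤ, ¬ (p : ℤ) ∣ k ∧ C k * g ∈ I) :
    baseChange (Int.castRingHom (ZMod p))
      (flatClosure (baseChange (algebraMap ℤ ℚ) I)) =
        baseChange (Int.castRingHom (ZMod p)) I := by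
  refine le_antisymm (Ideal.map_le_iff_le_comap.2 fun g hg => ?_)
    (Ideal.map_mono (le_flatClosure I))
  obtain ⟨k, hk, hkg⟩ := h g hg
  have hk0 : Int.castRingHom (ZMod p) k ≠ 0 := by
    rwa [eq_intCast, Ne, ZMod.intCast_zmod_eq_zero_iff_dvd]
  have h1 := Ideal.mem_map_of_mem (map (Int.castRingHom (ZMod p))) hkg
  rw [map_mul, map_C] at h1
  exact (Ideal.unit_mul_mem_iff_mem _ (IsUnit.map C (isUnit_iff_ne_zero.2 hk0))).1 h1

theorem eventually_dvd_factorial {d : ℤ} (hd : d ≠ 0) :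
    ∀ᶠ N : ℕ in atTop, d ∣ (N.factorial : ℤ) := by
  filter_upwards [eventually_ge_atTop d.natAbs] with N hN
  exact Int.dvd_natCast.2 (Nat.dvd_factorial (Int.natAbs_pos.2 hd) hN)

variable {f : MvPolynomial (Fin n) ℤ} {A : Finset (Fin n)}

/-- Finiteness is known only for the rational family, so N may depend only on it. The exponent e may
grow along a construction, but no new primes enter. -/
theorem Constructed.exists_C_pow_mul_mem {N : ℤ}
    (hspan : ∀ g, ∀ k : ℤ, k ≠ 0 → C k * g ∈ Ideal.span {f} → C N * g ∈ Ideal.span {f})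
    (hsup : ∀ J ∈ rationalFamily f, ∀ K ∈ rationalFamily f, ∀ g ∈ flatClosure (J ⊔ K),
      C N * g ∈ flatClosure J ⊔ flatClosure K)
    {I : Ideal (MvPolynomial (Fin n) ℤ)} (hI : Constructed f I) :
    ∀ g ∈ flatClosure (baseChange (algebraMap ℤ ℚ) I), ∃ e, C (N ^ e) * g ∈ I := by
  induction hI with
  | hypersurface =>
    intro g hg
    obtain ⟨k, hk, hkg⟩ := mem_flatClosure_baseChange.1 hg
    exact ⟨1, by rw [pow_one]; exact hspan g k hk hkg⟩
  | @intersection I J hI hJ h1 h2 =>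
    intro g hg
    rw [baseChange, Ideal.map_sup] at hg
    obtain ⟨a, ha, b, hb, hab⟩ := Submodule.mem_sup.1 (hsup _ ⟨I, hI, rfl⟩ _ ⟨J, hJ, rfl⟩ g hg)
    obtain ⟨e, he⟩ := h1 a ha
    obtain ⟨e', he'⟩ := h2 b hb
    refine ⟨e + e' + 1, ?_⟩
    have h3 : C (N ^ (e + e' + 1)) * g = C (N ^ e') * (C (N ^ e) * a) +
        C (N ^ e) * (C (N ^ e') * b) := by
      rw [pow_succ, C_mul, mul_assoc, ← hab, pow_add, C_mul]
      ring
    rw [h3]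
    exact Submodule.add_mem_sup (I.mul_mem_left _ he) (J.mul_mem_left _ he')
  | @union I J _ _ h1 h2 =>
    intro g hg
    obtain ⟨e, he⟩ := h1 g (Ideal.comap_mono (Ideal.map_mono inf_le_left) hg)
    obtain ⟨e', he'⟩ := h2 g (Ideal.comap_mono (Ideal.map_mono inf_le_right) hg)
    refine ⟨e + e', ?_, ?_⟩
    · rw [pow_add, C_mul, mul_right_comm]
      exact I.mul_mem_right _ he
    · rw [pow_add, C_mul, mul_assoc]
      exact J.mul_mem_left _ he'
  | @component I P _ hP ih =>
    intro g hg
    by_cases hN : C N ∈ P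
    -- If N ∉ P, then P contains the flat closure of I and is minimal over it. Hence P is contracted
    -- from a prime over ℚ and is already saturated.
    · exact ⟨1, by rw [pow_one]; exact P.mul_mem_right _ hN⟩
    have hPp := hP.1.1
    have hle : flatClosure (baseChange (algebraMap ℤ ℚ) I) ≤ P := fun a ha => by
      obtain ⟨e, he⟩ := ih a ha
      refine (hPp.mem_or_mem (hP.1.2 he)).resolve_left fun h => hN ?_
      rw [C_pow] at h
      exact hPp.mem_of_pow_mem _ h
    have hmin : P ∈ (flatClosure (baseChange (algebraMap ℤ ℚ) I)).minimalPrimes :=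
      ⟨⟨hPp, hle⟩, fun Q hQ => hP.2 ⟨hQ.1, (le_flatClosure I).trans hQ.2⟩⟩
    obtain ⟨Q, hQ, rfl⟩ := Ideal.exists_minimalPrimes_comap_eq _ P hmin
    refine ⟨0, ?_⟩
    rw [pow_zero, C_1, one_mul]
    exact Ideal.comap_mono Ideal.map_comap_le hg

/-- The conditions on an integer `N` under which the schemes constructed from `f = 0` behave
uniformly away from `N`. -/
structure IsGoodModulus (N : ℕ) (f : MvPolynomial (Fin n) ℤ) : Prop where
  not_dvd : ∀ p : ℕ, p.Prime → ¬ p ∣ N → ¬ (p : ℤ) ∣ MonomialOrder.lex.leadingCoeff f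
  saturated : ∀ I, Constructed f I → ∀ g, ∀ k : ℤ, k ≠ 0 → C k * g ∈ I →
    ∃ e, C ((N : ℤ) ^ e) * g ∈ I
  exists_squarefree : ∀ I, Constructed f I → ∀ u ∈ I, u ≠ 0 → ∃ v ∈ I,
    MonomialOrder.lex.degree v = squarefreeExp (MonomialOrder.lex.degree u).support ∧
      ∃ e, MonomialOrder.lex.leadingCoeff v ∣ (N : ℤ) ^ e
  isCompatiblySplit : ∀ I, Constructed f I → ∀ (p : ℕ) [Fact p.Prime], ¬ p ∣ N →
    IsCompatiblySplit p (map (Int.castRingHom (ZMod p)) f)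
      (baseChange (Int.castRingHom (ZMod p)) I)

theorem eventually_isCompatiblySplit_flatClosure (hf : f ≠ 0)
    (hlead : MonomialOrder.lex.degree f = squarefreeExp A) {J : Ideal (MvPolynomial (Fin n) ℚ)}
    (hJ : J ∈ rationalFamily f) :
    ∀ᶠ p : ℕ in atTop, ∀ _ : Fact p.Prime,
      IsCompatiblySplit p (map (Int.castRingHom (ZMod p)) f)
        (baseChange (Int.castRingHom (ZMod p)) (flatClosure J)) := by
  obtain ⟨I, hI, rfl⟩ := hJ
  obtain ⟨d, hd, h⟩ := exists_forall_C_mul_mem I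
  filter_upwards [Constructed.eventually_isCompatiblySplit hf hlead hI, eventually_not_dvd hd]
    with p h1 h2 hp
  have h3 := baseChange_zmod_flatClosure (p := p) (I := I) fun g hg => by
    obtain ⟨k, hk, hkg⟩ := mem_flatClosure_baseChange.1 hg
    exact ⟨d, h2, h g k hk hkg⟩
  exact h3 ▸ h1 hp

theorem exists_isGoodModulus (hf : f ≠ 0)
    (hlead : MonomialOrder.lex.degree f = squarefreeExp A) : ∃ N, N ≠ 0 ∧ IsGoodModulus N f := by
  have hfin := finite_rationalFamily hf hlead
  have hlc := MonomialOrder.lex.leadingCoeff_ne_zero_iff.2 hf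
  obtain ⟨d, hd, hdspan⟩ := exists_forall_C_mul_mem (Ideal.span {f})
  have hC : ∀ {a b : ℤ}, a ∣ b → ∀ {K : Ideal (MvPolynomial (Fin n) ℤ)} {g}, C a * g ∈ K →
      C b * g ∈ K := by
    rintro a _ ⟨r, rfl⟩ K g h
    rw [mul_comm a, C_mul, mul_assoc]
    exact K.mul_mem_left _ h
  have h1 : ∀ᶠ M : ℕ in atTop, ∀ J ∈ rationalFamily f, ∀ K ∈ rationalFamily f,
      ∀ g ∈ flatClosure (J ⊔ K),
        C (M.factorial : ℤ) * g ∈ flatClosure J ⊔ flatClosure K := by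
    refine (eventually_all_finite hfin).2 fun J _ => (eventually_all_finite hfin).2 fun K _ => ?_
    obtain ⟨d, hd, h⟩ := exists_forall_C_mul_mem_sup J K
    filter_upwards [eventually_dvd_factorial hd] with M hM g hg
    exact hC hM (h g hg)
  have h2 : ∀ᶠ M : ℕ in atTop, ∀ J ∈ rationalFamily f,
      ∀ B ∈ squarefreeLeads MonomialOrder.lex J, ∃ v ∈ flatClosure J,
        MonomialOrder.lex.degree v = squarefreeExp B ∧
          MonomialOrder.lex.leadingCoeff v ∣ (M.factorial : ℤ) := by
    refine (eventually_all_finite hfin).2 fun J hJ =>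
      (eventually_all_finite (Set.toFinite _)).2 fun B hB => ?_
    obtain ⟨I, hI, rfl⟩ := hJ
    obtain ⟨u, hu, hum, hud⟩ := hB
    obtain ⟨v, hv, hv0, hvd⟩ := exists_degree_eq_of_mem_baseChange (m := MonomialOrder.lex)
      (nonZeroDivisors ℤ) intCast_rat_injective hu hum.ne_zero
    filter_upwards [eventually_dvd_factorial (MonomialOrder.lex.leadingCoeff_ne_zero_iff.2 hv0)]
      with M hM
    exact ⟨v, le_flatClosure I hv, hvd.trans hud, hM⟩
  have h3 : ∀ᶠ M : ℕ in atTop, ∀ J ∈ rationalFamily f, ∀ p, M ≤ p → ∀ _ : Fact p.Prime,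
      IsCompatiblySplit p (map (Int.castRingHom (ZMod p)) f)
        (baseChange (Int.castRingHom (ZMod p)) (flatClosure J)) :=
    (eventually_all_finite hfin).2 fun J hJ => eventually_forall_ge_atTop.2
      (eventually_isCompatiblySplit_flatClosure hf hlead hJ)
  obtain ⟨M, h1, h2, h3, h4, h5⟩ := (h1.and (h2.and (h3.and ((eventually_dvd_factorial hlc).and
    (eventually_dvd_factorial hd))))).exists
  have hsat : ∀ I, Constructed f I → ∀ g ∈ flatClosure (baseChange (algebraMap ℤ ℚ) I),
      ∃ e, C ((M.factorial : ℤ) ^ e) * g ∈ I := fun I hI =>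
    Constructed.exists_C_pow_mul_mem (fun g k hk hg => hC h5 (hdspan g k hk hg)) h1 hI
  -- The factorial is divisible by the finitely many required integers, and a prime not dividing it
  -- is at least M, beyond the bounds for compatible splitting.
  refine ⟨M.factorial, M.factorial_ne_zero, ?_, ?_, ?_, ?_⟩
  · exact fun p _ hpN hp => hpN (Int.natCast_dvd_natCast.1 (hp.trans h4))
  · exact fun I hI g k hk hg => hsat I hI g (mem_flatClosure_baseChange.2 ⟨k, hk, hg⟩)
  · intro I hI u hu hu0
    have hlcu : algebraMap ℤ ℚ (MonomialOrder.lex.leadingCoeff u) ≠ 0 :=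
      (map_ne_zero_iff _ intCast_rat_injective).2 (MonomialOrder.lex.leadingCoeff_ne_zero_iff.2 hu0)
    have hu0' : map (algebraMap ℤ ℚ) u ≠ 0 :=
      (map_ne_zero_iff _ (map_injective _ intCast_rat_injective)).2 hu0
    have hB := Constructed.hasSquarefreeLeads_rat hf hlead hI _ (Ideal.mem_map_of_mem _ hu) hu0'
    rw [degree_map_of_ne_zero _ hlcu] at hB
    obtain ⟨v, hv, hvd, hvl⟩ := h2 _ ⟨I, hI, rfl⟩ _ hB
    obtain ⟨e, he⟩ := hsat I hI v hv
    have hMe : (M.factorial : ℤ) ^ e ≠ 0 := pow_ne_zero _ (by exact_mod_cast M.factorial_ne_zero)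
    have hv0 : v ≠ 0 := by
      rintro rfl
      rw [MonomialOrder.leadingCoeff_zero, zero_dvd_iff] at hvl
      exact M.factorial_ne_zero (by exact_mod_cast hvl)
    -- The element v lies only in the flat closure; N ^ e moves it into I, and one more factor N
    -- absorbs its own leading coefficient.
    refine ⟨_, he, ?_, e + 1, ?_⟩
    · rw [MonomialOrder.degree_mul (C_ne_zero.2 hMe) hv0, MonomialOrder.degree_C, zero_add, hvd]
    · rw [MonomialOrder.leadingCoeff_mul, MonomialOrder.leadingCoeff_C, pow_succ]
      exact mul_dvd_mul_left _ hvl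
  · intro I hI p hp hpN
    have hpM : M ≤ p := by
      by_contra! hlt
      exact hpN (Nat.dvd_factorial hp.out.pos hlt.le)
    have h6 := baseChange_zmod_flatClosure (p := p) (I := I) fun g hg => by
      obtain ⟨e, he⟩ := hsat I hI g hg
      refine ⟨_, fun hdvd => hpN ?_, he⟩
      exact Int.natCast_dvd_natCast.1 ((Nat.prime_iff_prime_int.1 hp.out).dvd_of_dvd_pow hdvd)
    exact h6 ▸ h3 _ ⟨I, hI, rfl⟩ p hpM hp

theorem IsGoodModulus.isReducedWithSRInitial {N : ℕ} (hN : N ≠ 0) (h : IsGoodModulus N f)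
    {I : Ideal (MvPolynomial (Fin n) ℤ)} (hI : Constructed f I) :
    IsReducedWithSRInitial (baseChange (algebraMap ℤ (Localization.Away (N : ℤ))) I) := by
  have hN0 : (N : ℤ) ≠ 0 := by exact_mod_cast hN
  have hle : Submonoid.powers (N : ℤ) ≤ nonZeroDivisors ℤ :=
    powers_le_nonZeroDivisors_of_noZeroDivisors hN0
  have : IsDomain (Localization.Away (N : ℤ)) := IsLocalization.isDomain_localization hle
  refine HasSquarefreeLeads.isReducedWithSRInitial (hasSquarefreeLeads_baseChange
    (Submonoid.powers (N : ℤ)) (IsLocalization.injective _ hle) fun u hu hu0 => ?_)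
  obtain ⟨v, hv, hvd, e, he⟩ := h.exists_squarefree I hI u hu hu0
  refine ⟨v, hv, hvd, isUnit_of_dvd_unit (map_dvd _ he) ?_⟩
  exact IsLocalization.map_units (Localization.Away (N : ℤ))
    (⟨_, e, rfl⟩ : Submonoid.powers (N : ℤ))

theorem IsGoodModulus.isCompatiblySplit_of_mem_modPFamily {N : ℕ} (h : IsGoodModulus N f)
    (hlead : MonomialOrder.lex.degree f = squarefreeExp A) {p : ℕ} [hp : Fact p.Prime]
    (hpN : ¬ p ∣ N) {I : Ideal (MvPolynomial (Fin n) (ZMod p))} (hI : I ∈ modPFamily p f) :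
    IsCompatiblySplit p (map (Int.castRingHom (ZMod p)) f) I := by
  obtain ⟨h1, h2⟩ := map_zmod_ne_zero (h.not_dvd p hp.out hpN)
  rcases hI with (⟨I, hI, rfl⟩ | hI) | hI
  · exact h.isCompatiblySplit I hI p hpN
  · exact Constructed.isCompatiblySplit h1 (h2.trans hlead) hI
  · exact hI

end GoodModulus

/-! ### Piecewise rational maps, their composition and constructibility. -/

section PiecewiseRational

variable {k K : Type*} [Field k] [Field K] [Algebra k K] {σ τ υ : Type*}

open Classical in
/-- The polynomials in `T` that vanish at `x`. -/
def vanishingAt (T : Finset (MvPolynomial σ k)) (x : σ → K) : Finset (MvPolynomial σ k) :=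
  T.filter fun t => aeval x t = 0

theorem mem_vanishingAt {T : Finset (MvPolynomial σ k)} {x : σ → K} {t : MvPolynomial σ k} :
    t ∈ vanishingAt T x ↔ t ∈ T ∧ aeval x t = 0 := by
  classical
  exact Finset.mem_filter

variable (k) in
/-- A map which is given by rational functions, chosen according to which of finitely many
polynomials vanish. -/
def IsPiecewiseRational (φ : (σ → K) → (τ → K)) : Prop :=
  ∃ (T : Finset (MvPolynomial σ k)) (h : Finset (MvPolynomial σ k) → MvPolynomial σ k)
    (g : Finset (MvPolynomial σ k) → τ → MvPolynomial σ k),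
    ∀ x, aeval x (h (vanishingAt T x)) ≠ 0 ∧
      ∀ j, φ x j = aeval x (g (vanishingAt T x) j) / aeval x (h (vanishingAt T x))

theorem isPiecewiseRational_id : IsPiecewiseRational k (id : (σ → K) → (σ → K)) :=
  ⟨∅, fun _ => 1, fun _ => X, fun x => by simp⟩

/-- The numerator of `P (g / h)` over the denominator `h ^ d`. -/
def substNumerator [Fintype τ] (g : τ → MvPolynomial σ k) (h : MvPolynomial σ k) (d : ℕ)
    (P : MvPolynomial τ k) : MvPolynomial σ k :=
  ∑ e ∈ P.support, C (coeff e P) * ((∏ j, g j ^ e j) * h ^ (d - e.degree))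

theorem aeval_substNumerator [Fintype τ] {g : τ → MvPolynomial σ k} {h : MvPolynomial σ k}
    {d : ℕ} {P : MvPolynomial τ k} (hd : P.totalDegree ≤ d) {x : σ → K} (hx : aeval x h ≠ 0)
    {y : τ → K} (hy : ∀ j, y j = aeval x (g j) / aeval x h) :
    aeval x (substNumerator g h d P) = aeval x h ^ d * aeval y P := by
  rw [substNumerator, map_sum, aeval_def y, eval₂_eq', Finset.mul_sum]
  refine Finset.sum_congr rfl fun e he => ?_
  have hed : e.degree ≤ d := (le_totalDegree he).trans hd
  have h1 : ∏ j, y j ^ e j = (∏ j, aeval x (g j) ^ e j) / aeval x h ^ e.degree := by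
    rw [Finsupp.degree_eq_sum, ← Finset.prod_pow_eq_pow_sum, ← Finset.prod_div_distrib]
    exact Finset.prod_congr rfl fun j _ => by rw [hy, div_pow]
  rw [map_mul, map_mul, map_prod, map_pow, algHom_C, h1]
  simp only [map_pow]
  have h2 : aeval x h ^ d = aeval x h ^ (d - e.degree) * aeval x h ^ e.degree := by
    rw [← pow_add, Nat.sub_add_cancel hed]
  rw [h2]
  field_simp

theorem IsPiecewiseRational.comp [Fintype τ] [Fintype υ] {φ : (σ → K) → (τ → K)}
    {ψ : (τ → K) → (υ → K)} (hψ : IsPiecewiseRational k ψ) (hφ : IsPiecewiseRational k φ) :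
    IsPiecewiseRational k (ψ ∘ φ) := by
  classical
  obtain ⟨T, h, g, H⟩ := hφ
  obtain ⟨T', h', g', H'⟩ := hψ
  let q : Finset (MvPolynomial σ k) → MvPolynomial τ k → MvPolynomial σ k := fun S t =>
    substNumerator (g S) (h S) t.totalDegree t
  -- Besides T, all numerators of t ∘ φ on all strata are tested, so the vanishing pattern at x
  -- determines the one at φ x; `restr` recovers it.
  let U : Finset (MvPolynomial σ k) :=
    T ∪ (T.powerset ×ˢ T').image fun s => q s.1 s.2
  let restr : Finset (MvPolynomial σ k) → Finset (MvPolynomial τ k) := fun S =>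
    T'.filter fun t => q (S ∩ T) t ∈ S
  -- A common bound on the degrees, so that the same power of the denominator of φ cancels from
  -- numerator and denominator of ψ ∘ φ.
  let d : Finset (MvPolynomial σ k) → ℕ := fun S =>
    (h' (restr S)).totalDegree + ∑ j, (g' (restr S) j).totalDegree
  refine ⟨U, fun S => substNumerator (g (S ∩ T)) (h (S ∩ T)) (d S) (h' (restr S)),
    fun S j => substNumerator (g (S ∩ T)) (h (S ∩ T)) (d S) (g' (restr S) j), fun x => ?_⟩
  obtain ⟨hx, hφx⟩ := H x
  obtain ⟨hy, hψy⟩ := H' (φ x)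
  have h1 : vanishingAt U x ∩ T = vanishingAt T x := by
    ext t
    simp only [Finset.mem_inter, mem_vanishingAt, U, Finset.mem_union]
    tauto
  have h2 : restr (vanishingAt U x) = vanishingAt T' (φ x) := by
    ext t
    simp only [restr, h1, Finset.mem_filter, mem_vanishingAt]
    refine and_congr_right fun ht => ?_
    have hU : q (vanishingAt T x) t ∈ U := by
      refine Finset.mem_union_right _ (Finset.mem_image.2 ⟨(vanishingAt T x, t), ?_, rfl⟩)
      refine Finset.mem_product.2 ⟨Finset.mem_powerset.2 fun s hs => ?_, ht⟩
      exact (mem_vanishingAt.1 hs).1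
    rw [and_iff_right hU]
    change aeval x (substNumerator _ _ _ _) = 0 ↔ _
    rw [aeval_substNumerator le_rfl hx hφx, mul_eq_zero, or_iff_right (pow_ne_zero _ hx)]
  have hd0 : (h' (vanishingAt T' (φ x))).totalDegree ≤ d (vanishingAt U x) := by
    simp only [d, h2]
    exact Nat.le_add_right _ _
  have hdj : ∀ j, (g' (vanishingAt T' (φ x)) j).totalDegree ≤ d (vanishingAt U x) := fun j => by
    simp only [d, h2]
    exact (Finset.single_le_sum (f := fun j => (g' (vanishingAt T' (φ x)) j).totalDegree)
      (fun _ _ => Nat.zero_le _) (Finset.mem_univ j)).trans (Nat.le_add_left _ _)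
  simp only [h1, h2]
  rw [aeval_substNumerator hd0 hx hφx]
  refine ⟨mul_ne_zero (pow_ne_zero _ hx) hy, fun j => ?_⟩
  rw [aeval_substNumerator (hdj j) hx hφx, mul_div_mul_left _ _ (pow_ne_zero _ hx)]
  exact hψy j

theorem IsPiecewiseRational.isConstructibleMap {n : ℕ}
    {φ : (Fin n → AlgebraicClosure k) → (Fin n → AlgebraicClosure k)}
    (hφ : IsPiecewiseRational k φ) : IsConstructibleMap k φ := by
  classical
  obtain ⟨T, h, g, H⟩ := hφ
  let E := T.powerset.equivFin
  let S : Fin T.powerset.card → Finset (MvPolynomial (Fin n) k) := fun a => (E.symm a).1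
  -- The stratum with vanishing set S is cut out by S and the nonvanishing of the rest of T; r
  -- enforces the latter and cancels from the quotient.
  let r : Fin T.powerset.card → MvPolynomial (Fin n) k := fun a => ∏ t ∈ T \ S a, t
  refine ⟨T.powerset.card, fun a => Ideal.span (S a), fun a => h (S a) * r a,
    fun a j => g (S a) j * r a, fun x => ?_, fun a x hx hxa j => ?_⟩
  · have hmem : vanishingAt T x ∈ T.powerset :=
      Finset.mem_powerset.2 fun s hs => (mem_vanishingAt.1 hs).1
    have hS : S (E ⟨_, hmem⟩) = vanishingAt T x := by simp [S]
    refine ⟨E ⟨_, hmem⟩, ?_, ?_⟩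
    · rw [zeroLocus_span, hS]
      exact fun t ht => (mem_vanishingAt.1 ht).2
    · rw [map_mul, hS, map_prod]
      refine mul_ne_zero (H x).1 (Finset.prod_ne_zero_iff.2 fun t ht => ?_)
      rw [hS, Finset.mem_sdiff, mem_vanishingAt] at ht
      tauto
  · rw [map_mul, mul_ne_zero_iff, map_prod, Finset.prod_ne_zero_iff] at hxa
    rw [zeroLocus_span] at hx
    have hST : S a ⊆ T := Finset.mem_powerset.1 (E.symm a).2
    have hS : vanishingAt T x = S a := by
      ext t
      rw [mem_vanishingAt]
      refine ⟨fun ⟨ht, h0⟩ => ?_, fun ht => ⟨hST ht, hx t ht⟩⟩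
      by_contra hn
      exact hxa.2 t (Finset.mem_sdiff.2 ⟨ht, hn⟩) h0
    have hr : aeval x (r a) ≠ 0 := by
      rw [map_prod]
      exact Finset.prod_ne_zero_iff.2 hxa.2
    rw [map_mul, map_mul, mul_div_mul_right _ _ hr, ← hS]
    exact (H x).2 j

end PiecewiseRational

/-! ### Partial lex leading forms, interpolating between u and its leading term. -/

section LeadPart

variable {n : ℕ} {R : Type*} [CommRing R]

/-- The exponents of the first `i` variables. -/
def truncExp (i : ℕ) (e : Fin n →₀ ℕ) : Fin n →₀ ℕ :=
  e.filter fun j => (j : ℕ) < i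

theorem truncExp_apply (i : ℕ) (e : Fin n →₀ ℕ) (j : Fin n) :
    truncExp i e j = if (j : ℕ) < i then e j else 0 :=
  Finsupp.filter_apply _ _ _

theorem truncExp_eq_iff {i : ℕ} {e d : Fin n →₀ ℕ} :
    truncExp i e = truncExp i d ↔ ∀ j : Fin n, (j : ℕ) < i → e j = d j := by
  rw [Finsupp.ext_iff]
  refine forall_congr' fun j => ?_
  rw [truncExp_apply, truncExp_apply]
  split_ifs with h <;> simp [h]

theorem truncExp_add (i : ℕ) (e d : Fin n →₀ ℕ) :
    truncExp i (e + d) = truncExp i e + truncExp i d :=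
  Finsupp.filter_add

theorem toLex_truncExp_le (i : ℕ) {e d : Fin n →₀ ℕ} (h : toLex e ≤ toLex d) :
    toLex (truncExp i e) ≤ toLex (truncExp i d) := by
  rcases h.eq_or_lt with h | h
  · rw [toLex.injective h]
  obtain ⟨j, h1, h2⟩ := Finsupp.Lex.lt_iff.1 h
  simp only [ofLex_toLex] at h1 h2
  by_cases hj : (j : ℕ) < i
  · refine (Finsupp.Lex.lt_iff.2 ⟨j, fun l hl => ?_, ?_⟩).le
    · simp only [ofLex_toLex, truncExp_apply, h1 l hl]
    · simpa only [ofLex_toLex, truncExp_apply, if_pos hj] using h2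
  · refine (congrArg toLex (truncExp_eq_iff.2 fun l hl => h1 l ?_)).le
    exact Fin.lt_def.2 (hl.trans_le (not_lt.1 hj))

/-- Exponents that agree in the first `i` variables are compared by the next variable first. -/
theorem apply_le_of_truncExp_eq {i : Fin n} {e d : Fin n →₀ ℕ} (h : toLex e ≤ toLex d)
    (ht : truncExp i e = truncExp i d) : e i ≤ d i := by
  by_contra! hlt
  refine h.not_gt (Finsupp.Lex.lt_iff.2 ⟨i, fun j hj => ?_, hlt⟩)
  exact (truncExp_eq_iff.1 ht j hj).symm

open Classical in
/-- The part of `u` whose monomials agree with `d` in the first `i` variables. -/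
def truncPart (i : ℕ) (d : Fin n →₀ ℕ) (u : MvPolynomial (Fin n) R) : MvPolynomial (Fin n) R :=
  ∑ e ∈ u.support with truncExp i e = truncExp i d, monomial e (coeff e u)

open Classical in
theorem coeff_truncPart (i : ℕ) (d e : Fin n →₀ ℕ) (u : MvPolynomial (Fin n) R) :
    coeff e (truncPart i d u) = if truncExp i e = truncExp i d then coeff e u else 0 := by
  rw [truncPart, coeff_sum]
  simp only [coeff_monomial, Finset.sum_ite_eq', Finset.mem_filter, mem_support_iff]
  by_cases h : coeff e u = 0 <;> simp [h]

theorem mem_support_truncPart {i : ℕ} {d e : Fin n →₀ ℕ} {u : MvPolynomial (Fin n) R} :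
    e ∈ (truncPart i d u).support ↔ e ∈ u.support ∧ truncExp i e = truncExp i d := by
  classical
  rw [mem_support_iff, mem_support_iff, coeff_truncPart]
  split_ifs with h <;> simp [h]

theorem truncPart_add (i : ℕ) (d : Fin n →₀ ℕ) (u v : MvPolynomial (Fin n) R) :
    truncPart i d (u + v) = truncPart i d u + truncPart i d v := by
  classical
  ext e
  simp only [coeff_add, coeff_truncPart]
  split_ifs <;> simp

theorem truncPart_congr {i : ℕ} {d d' : Fin n →₀ ℕ} (h : truncExp i d = truncExp i d')
    (u : MvPolynomial (Fin n) R) : truncPart i d u = truncPart i d' u := by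
  rw [truncPart, truncPart, h]

/-- The part of `u` whose monomials agree with the lex leading monomial in the first `i`
variables. -/
def leadPart (i : ℕ) (u : MvPolynomial (Fin n) R) : MvPolynomial (Fin n) R :=
  truncPart i (MonomialOrder.lex.degree u) u

theorem mem_support_leadPart {i : ℕ} {e : Fin n →₀ ℕ} {u : MvPolynomial (Fin n) R} :
    e ∈ (leadPart i u).support ↔
      e ∈ u.support ∧ truncExp i e = truncExp i (MonomialOrder.lex.degree u) :=
  mem_support_truncPart

@[simp]
theorem leadPart_zero (i : ℕ) : leadPart i (0 : MvPolynomial (Fin n) R) = 0 := by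
  simp [leadPart, truncPart]

theorem leadPart_zero_left (u : MvPolynomial (Fin n) R) : leadPart 0 u = u := by
  classical
  ext e
  rw [leadPart, coeff_truncPart,
    if_pos (truncExp_eq_iff.2 fun j hj => absurd hj (Nat.not_lt_zero _))]

theorem leadPart_self (u : MvPolynomial (Fin n) R) :
    leadPart n u = MonomialOrder.lex.leadingTerm u := by
  classical
  ext e
  have h : truncExp n e = truncExp n (MonomialOrder.lex.degree u) ↔
      MonomialOrder.lex.degree u = e := by
    rw [truncExp_eq_iff, Finsupp.ext_iff]
    exact forall_congr' fun j => ⟨fun h => (h j.2).symm, fun h _ => h.symm⟩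
  rw [leadPart, coeff_truncPart, MonomialOrder.leadingTerm, coeff_monomial, if_congr h rfl rfl]
  split_ifs with h1
  · rw [← h1, MonomialOrder.leadingCoeff]
  · rfl

theorem toLex_le_degree {u : MvPolynomial (Fin n) R} {e : Fin n →₀ ℕ} (h : coeff e u ≠ 0) :
    toLex e ≤ toLex (MonomialOrder.lex.degree u) :=
  MonomialOrder.lex_le_iff.1 (MonomialOrder.lex.le_degree (mem_support_iff.2 h))

/-- Truncated exponents of monomials of u and v are at most those of the leading monomials, so their
sum attains the maximum only if both do. -/
theorem truncPart_mul (i : ℕ) (u v : MvPolynomial (Fin n) R) :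
    truncPart i (MonomialOrder.lex.degree u + MonomialOrder.lex.degree v) (u * v) =
      leadPart i u * leadPart i v := by
  classical
  ext e
  rw [coeff_truncPart, coeff_mul, coeff_mul]
  trans ∑ x ∈ Finset.HasAntidiagonal.antidiagonal e, if truncExp i e =
      truncExp i (MonomialOrder.lex.degree u + MonomialOrder.lex.degree v) then
    coeff x.1 u * coeff x.2 v else 0
  · split_ifs <;> simp
  refine Finset.sum_congr rfl fun x hx => ?_
  rw [Finset.HasAntidiagonal.mem_antidiagonal] at hx
  rw [leadPart, leadPart, coeff_truncPart, coeff_truncPart, ← hx, truncExp_add, truncExp_add]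
  by_cases hu : coeff x.1 u = 0
  · simp [hu]
  by_cases hv : coeff x.2 v = 0
  · simp [hv]
  have h1 := toLex_truncExp_le i (toLex_le_degree hu)
  have h2 := toLex_truncExp_le i (toLex_le_degree hv)
  have h3 : truncExp i x.1 + truncExp i x.2 = truncExp i (MonomialOrder.lex.degree u) +
      truncExp i (MonomialOrder.lex.degree v) ↔
      truncExp i x.1 = truncExp i (MonomialOrder.lex.degree u) ∧
        truncExp i x.2 = truncExp i (MonomialOrder.lex.degree v) := by
    rw [← toLex_inj, toLex_add, toLex_add, add_eq_add_iff_eq_and_eq h1 h2, toLex_inj, toLex_inj]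
  simp only [h3, ite_and]
  split_ifs <;> simp

/-- A polynomial of smaller degree contributes its own leading part or nothing. -/
theorem truncPart_eq_leadPart_or {i : ℕ} {d : Fin n →₀ ℕ} {v : MvPolynomial (Fin n) R}
    (h : toLex (MonomialOrder.lex.degree v) ≤ toLex d) :
    truncPart i d v = leadPart i v ∨ truncPart i d v = 0 := by
  classical
  by_cases ht : truncExp i (MonomialOrder.lex.degree v) = truncExp i d
  · exact .inl (truncPart_congr ht.symm v)
  · right
    ext e
    rw [coeff_truncPart, coeff_zero]
    split_ifs with he
    · by_contra hne
      have h1 := toLex_truncExp_le i (toLex_le_degree hne)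
      rw [he] at h1
      exact ht (toLex.injective (le_antisymm (toLex_truncExp_le i h) h1))
    · rfl

variable [IsDomain R]

theorem leadPart_mul (i : ℕ) {u v : MvPolynomial (Fin n) R} (hu : u ≠ 0) (hv : v ≠ 0) :
    leadPart i (u * v) = leadPart i u * leadPart i v := by
  rw [← truncPart_mul, leadPart, MonomialOrder.degree_mul hu hv]

/-- The leading parts of an ideal vanish where those of a basis do. -/
theorem IsSquarefreeBasis.aeval_leadPart_eq_zero {K : Type*} [Field K] [Algebra R K]
    {I : Ideal (MvPolynomial (Fin n) R)} {B : Set (MvPolynomial (Fin n) R)}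
    (hB : IsSquarefreeBasis MonomialOrder.lex I B) {i : ℕ} {y : Fin n → K}
    (hy : ∀ h ∈ B, aeval y (leadPart i h) = 0) {u : MvPolynomial (Fin n) R} (hu : u ∈ I) :
    aeval y (leadPart i u) = 0 := by
  refine hB.induction (Q := fun u => aeval y (leadPart i u) = 0) (by simp) ?_ hu
  intro v h b a _ hh ha hlt hd hv
  have h0 := (hB.monic h hh).ne_zero
  have h1 : toLex (MonomialOrder.lex.degree v) ≤ toLex (b + MonomialOrder.lex.degree h) := by
    by_cases hv0 : v = 0
    · rw [hv0, MonomialOrder.degree_zero]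
      exact Finsupp.toLex_monotone zero_le
    · exact (MonomialOrder.lex_lt_iff.1 (hlt hv0)).le
  have h2 : truncPart i (b + MonomialOrder.lex.degree h) (monomial b a * h) =
      leadPart i (monomial b a) * leadPart i h := by
    classical
    rw [← truncPart_mul, MonomialOrder.degree_monomial, if_neg ha]
  rw [leadPart, hd, truncPart_add, map_add, h2, map_mul, hy h hh, mul_zero, add_zero]
  rcases truncPart_eq_leadPart_or h1 with h3 | h3
  · rw [h3, hv]
  · rw [h3, map_zero]

end LeadPart

/-! ### Leading parts on lines parallel to an axis. -/

section Evaluation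

variable {n : ℕ} {R K : Type*} [CommRing R] [Field K] [Algebra R K]

theorem aeval_update_of_forall_eq {q : MvPolynomial (Fin n) R} {i : Fin n} {c : ℕ}
    (hq : ∀ e ∈ q.support, e i = c) (x : Fin n → K) (t : K) :
    aeval (Function.update x i t) q = t ^ c * aeval (Function.update x i 1) q := by
  rw [aeval_def, aeval_def, eval₂_eq', eval₂_eq', Finset.mul_sum]
  refine Finset.sum_congr rfl fun e he => ?_
  rw [mul_left_comm]
  congr 1
  rw [← Finset.mul_prod_erase _ _ (Finset.mem_univ i),
    ← Finset.mul_prod_erase (a := i) _ _ (Finset.mem_univ i)]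
  simp only [Function.update_self, one_pow, one_mul, hq e he]
  congr 1
  refine Finset.prod_congr rfl fun j hj => ?_
  rw [Function.update_of_ne (Finset.ne_of_mem_erase hj),
    Function.update_of_ne (Finset.ne_of_mem_erase hj)]

/-- Substitution of a constant for the variable `X i`. -/
def specialize (i : Fin n) (c : R) (q : MvPolynomial (Fin n) R) : MvPolynomial (Fin n) R :=
  aeval (Function.update X i (C c)) q

theorem aeval_specialize (i : Fin n) (c : R) (q : MvPolynomial (Fin n) R) (x : Fin n → K) :
    aeval x (specialize i c q) = aeval (Function.update x i (algebraMap R K c)) q := by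
  rw [specialize, ← AlgHom.comp_apply, comp_aeval]
  congr 2
  ext j
  by_cases hj : j = i
  · subst hj; simp
  · simp [hj]

open Classical in
/-- The coefficient of `X i` in `leadPart i h`. -/
def slope (i : Fin n) (h : MvPolynomial (Fin n) R) : MvPolynomial (Fin n) R :=
  if MonomialOrder.lex.degree h i = 1 then specialize i 1 (leadPart (i + 1) h) else 0

/-- The part of `leadPart i h` that does not involve `X i`. -/
def intercept (i : Fin n) (h : MvPolynomial (Fin n) R) : MvPolynomial (Fin n) R :=
  specialize i 0 (leadPart i h)

theorem aeval_update_slope (i : Fin n) (h : MvPolynomial (Fin n) R) (x : Fin n → K) (t : K) :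
    aeval (Function.update x i t) (slope i h) = aeval x (slope i h) := by
  rw [slope]
  split_ifs
  · rw [aeval_specialize, aeval_specialize, Function.update_idem]
  · simp

theorem aeval_update_intercept (i : Fin n) (h : MvPolynomial (Fin n) R) (x : Fin n → K) (t : K) :
    aeval (Function.update x i t) (intercept i h) = aeval x (intercept i h) := by
  rw [intercept, aeval_specialize, aeval_specialize, Function.update_idem]

theorem truncExp_succ_eq_iff {i : Fin n} {e d : Fin n →₀ ℕ} :
    truncExp (i + 1) e = truncExp (i + 1) d ↔ truncExp i e = truncExp i d ∧ e i = d i := by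
  simp only [truncExp_eq_iff]
  refine ⟨fun h => ⟨fun j hj => h j (hj.trans (Nat.lt_succ_self _)), h i (Nat.lt_succ_self _)⟩,
    fun ⟨h1, h2⟩ j hj => ?_⟩
  rcases (Nat.lt_succ_iff.1 hj).lt_or_eq with h | h
  · exact h1 j h
  · rw [Fin.ext h, h2]

theorem aeval_update_leadPart_succ {i : Fin n} {h : MvPolynomial (Fin n) R}
    (hd : MonomialOrder.lex.degree h i = 1) (x : Fin n → K) (t : K) :
    aeval (Function.update x i t) (leadPart (i + 1) h) = t * aeval x (slope i h) := by
  rw [slope, if_pos hd, aeval_specialize, map_one, aeval_update_of_forall_eq (c := 1), pow_one]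
  intro e he
  rw [← hd]
  exact (truncExp_succ_eq_iff.1 (mem_support_leadPart.1 he).2).2

theorem aeval_update_leadPart_succ_of_eq_zero {i : Fin n} {h : MvPolynomial (Fin n) R}
    (hd : MonomialOrder.lex.degree h i = 0) (x : Fin n → K) (t : K) :
    aeval (Function.update x i t) (leadPart (i + 1) h) = aeval x (intercept i h) := by
  classical
  have h1 : leadPart (i + 1) h = leadPart i h := by
    ext e
    rw [leadPart, leadPart, coeff_truncPart, coeff_truncPart]
    by_cases he : coeff e h = 0
    · simp [he]
    refine if_congr (truncExp_succ_eq_iff.trans (and_iff_left_of_imp fun ht => ?_)) rfl rfl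
    have := apply_le_of_truncExp_eq (toLex_le_degree he) ht
    omega
  have h2 : ∀ e ∈ (leadPart i h).support, e i = 0 := fun e he => by
    rw [← h1] at he
    rw [← hd]
    exact (truncExp_succ_eq_iff.1 (mem_support_leadPart.1 he).2).2
  rw [intercept, aeval_specialize, h1, aeval_update_of_forall_eq h2,
    aeval_update_of_forall_eq h2 x (algebraMap R K 0), pow_zero, pow_zero]

/-- Among monomials agreeing with the leading one in the earlier variables, the exponent of X i is
at most its value at the leading monomial. With that value at most 1, the leading part is linear in
X i. -/
theorem aeval_update_leadPart {i : Fin n} {h : MvPolynomial (Fin n) R}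
    (hd : MonomialOrder.lex.degree h i ≤ 1) (x : Fin n → K) (t : K) :
    aeval (Function.update x i t) (leadPart i h) =
      t * aeval x (slope i h) + aeval x (intercept i h) := by
  classical
  have h1 : ∀ e ∈ (leadPart i h - leadPart (i + 1) h).support, e i = 0 := by
    intro e he
    rw [mem_support_iff, coeff_sub, leadPart, leadPart, coeff_truncPart, coeff_truncPart] at he
    by_contra hne
    refine he ?_
    by_cases hc : coeff e h = 0
    · simp [hc]
    rw [sub_eq_zero]
    refine (if_congr (truncExp_succ_eq_iff.trans (and_iff_left_of_imp fun ht => ?_)) rfl rfl).symm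
    have := apply_le_of_truncExp_eq (toLex_le_degree hc) ht
    omega
  have h2 : ∀ s, aeval (Function.update x i s) (leadPart i h) =
      aeval (Function.update x i s) (leadPart (i + 1) h) +
        aeval (Function.update x i 1) (leadPart i h - leadPart (i + 1) h) := fun s => by
    have h3 := aeval_update_of_forall_eq h1 x s
    rw [pow_zero, one_mul] at h3
    rw [← h3, map_sub, add_sub_cancel]
  rw [intercept, aeval_specialize, map_zero, h2, h2 0]
  rcases Nat.le_one_iff_eq_zero_or_eq_one.1 hd with hd | hd
  · rw [aeval_update_leadPart_succ_of_eq_zero hd, aeval_update_leadPart_succ_of_eq_zero hd, slope,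
      if_neg (by omega), map_zero, mul_zero, zero_add]
  · rw [aeval_update_leadPart_succ hd, aeval_update_leadPart_succ hd, zero_mul, zero_add]

end Evaluation

/-! ### The shears and their composition. -/

section Bijection

variable {n : ℕ} {k K : Type*} [Field k] [Field K] [Algebra k K]

variable (K) in
/-- The common zeros of the leading parts with respect to the first `i` variables of the elements
of `I`. -/
def leadZeroLocus (i : ℕ) (I : Ideal (MvPolynomial (Fin n) k)) : Set (Fin n → K) :=
  {x | ∀ u ∈ I, aeval x (leadPart i u) = 0}

theorem leadZeroLocus_anti {i : ℕ} {I J : Ideal (MvPolynomial (Fin n) k)} (h : I ≤ J) :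
    leadZeroLocus K i J ⊆ leadZeroLocus K i I :=
  fun _ hx u hu => hx u (h hu)

theorem IsSquarefreeBasis.degree_apply_le_one {m : MonomialOrder (Fin n)}
    {I : Ideal (MvPolynomial (Fin n) k)} {B : Set (MvPolynomial (Fin n) k)}
    (hB : IsSquarefreeBasis m I B) {h : MvPolynomial (Fin n) k} (hh : h ∈ B) (i : Fin n) :
    m.degree h i ≤ 1 := by
  rw [hB.degree_eq h hh, squarefreeExp_apply]
  split_ifs <;> omega

theorem degree_apply_of_aeval_slope_ne_zero {i : Fin n} {h : MvPolynomial (Fin n) k}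
    {x : Fin n → K} (hx : aeval x (slope i h) ≠ 0) : MonomialOrder.lex.degree h i = 1 := by
  by_contra hne
  rw [slope, if_neg hne, map_zero] at hx
  exact hx rfl

/-- On a line parallel to the `i`-th axis, all the loci that meet it properly do so in the same
point. -/
theorem eq_of_aeval_slope_ne_zero {i : Fin n} {I J : Ideal (MvPolynomial (Fin n) k)}
    (hIJ : HasSquarefreeLeads MonomialOrder.lex (I ⊓ J)) {x : Fin n → K} {s t : K}
    (hs : Function.update x i s ∈ leadZeroLocus K i I)
    (ht : Function.update x i t ∈ leadZeroLocus K i J) {g h : MvPolynomial (Fin n) k}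
    (hg : g ∈ I) (hh : h ∈ J) (hgx : aeval x (slope i g) ≠ 0) (hhx : aeval x (slope i h) ≠ 0) :
    s = t := by
  by_contra hst
  have hgd := degree_apply_of_aeval_slope_ne_zero hgx
  have hhd := degree_apply_of_aeval_slope_ne_zero hhx
  have hg0 : g ≠ 0 := by rintro rfl; simp at hgd
  have hh0 : h ≠ 0 := by rintro rfl; simp at hhd
  obtain ⟨B, -, hB⟩ := hIJ.exists_finite_isSquarefreeBasis
  -- Each basis element of I ⊓ J restricts to a linear function on the line with two distinct zeros
  -- s and t, so its slope and intercept both vanish.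
  have h1 : ∀ b ∈ B, aeval (Function.update x i (1 : K)) (leadPart (i + 1) b) = 0 := by
    intro b hb
    have hbd := hB.degree_apply_le_one hb i
    have h2 := leadZeroLocus_anti inf_le_left hs b (hB.mem b hb)
    have h3 := leadZeroLocus_anti inf_le_right ht b (hB.mem b hb)
    rw [aeval_update_leadPart hbd] at h2 h3
    have h4 : aeval x (slope i b) = 0 := by
      have h5 : (s - t) * aeval x (slope i b) = 0 := by linear_combination h2 - h3
      exact (mul_eq_zero.1 h5).resolve_left (sub_ne_zero.2 hst)
    rcases Nat.le_one_iff_eq_zero_or_eq_one.1 hbd with hbd | hbd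
    · rw [aeval_update_leadPart_succ_of_eq_zero hbd]
      rwa [h4, mul_zero, zero_add] at h2
    · rw [aeval_update_leadPart_succ hbd, h4, mul_zero]
  -- But g h ∈ I ⊓ J, and its next leading part takes at X i = 1 the value of the product of two
  -- nonzero slopes.
  have h2 := hB.aeval_leadPart_eq_zero h1 (u := g * h) ⟨I.mul_mem_right _ hg, J.mul_mem_left _ hh⟩
  rw [leadPart_mul _ hg0 hh0, map_mul, aeval_update_leadPart_succ hgd,
    aeval_update_leadPart_succ hhd, one_mul, one_mul] at h2
  exact mul_ne_zero hgx hhx h2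

/-- The equation for the zero of the linear form of `h` to be a zero of that of `b`. -/
def slopeRelation (i : Fin n) (h b : MvPolynomial (Fin n) k) : MvPolynomial (Fin n) k :=
  slope i h * intercept i b - slope i b * intercept i h

variable {F : Set (Ideal (MvPolynomial (Fin n) k))}

/-- A single shear along the `i`-th axis carries all the loci of one stage into those of the
next. -/
theorem exists_bijective_mapsTo_leadZeroLocus (hF : ∀ I ∈ F, HasSquarefreeLeads MonomialOrder.lex I)
    (hinf : ∀ I ∈ F, ∀ J ∈ F, I ⊓ J ∈ F) (i : Fin n) :
    ∃ φ : (Fin n → K) → (Fin n → K), Function.Bijective φ ∧ IsPiecewiseRational k φ ∧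
      ∀ I ∈ F, Set.MapsTo φ (leadZeroLocus K i I) (leadZeroLocus K (i + 1) I) := by
  classical
  have hfin : F.Finite := finite_of_hasSquarefreeLeads hF hinf
  choose! B hBfin hB using fun I (hI : I ∈ F) => (hF I hI).exists_finite_isSquarefreeBasis
  let U : Set (MvPolynomial (Fin n) k) := ⋃ I ∈ F, B I
  have hU : U.Finite := hfin.biUnion hBfin
  let T : Finset (MvPolynomial (Fin n) k) :=
    hU.toFinset.image (slope i) ∪
      (hU.toFinset ×ˢ hU.toFinset).image fun s => slopeRelation i s.1 s.2
  have hTs : ∀ I ∈ F, ∀ h ∈ B I, slope i h ∈ T := fun I hI h hh =>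
    Finset.mem_union_left _ (Finset.mem_image_of_mem _
      (hU.mem_toFinset.2 (Set.mem_biUnion hI hh)))
  have hTr : ∀ I ∈ F, ∀ h ∈ B I, ∀ b ∈ B I, slopeRelation i h b ∈ T := fun I hI h hh b hb =>
    Finset.mem_union_right _ (Finset.mem_image.2 ⟨(h, b), Finset.mem_product.2
      ⟨hU.mem_toFinset.2 (Set.mem_biUnion hI hh), hU.mem_toFinset.2 (Set.mem_biUnion hI hb)⟩, rfl⟩)
  have hT : ∀ (x : Fin n → K) (t : K), vanishingAt T (Function.update x i t) = vanishingAt T x := by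
    intro x t
    ext q
    rw [mem_vanishingAt, mem_vanishingAt]
    refine and_congr_right fun hq => ?_
    rcases Finset.mem_union.1 hq with hq | hq
    · obtain ⟨h, -, rfl⟩ := Finset.mem_image.1 hq
      rw [aeval_update_slope]
    · obtain ⟨s, -, rfl⟩ := Finset.mem_image.1 hq
      simp only [slopeRelation, map_sub, map_mul, aeval_update_slope, aeval_update_intercept]
  -- For a vanishing pattern S: the zero of the linear form of h on the line is a common zero of the
  -- forms of all of `B I`. As the tests do not involve X i, S and the choice of h are constant
  -- along the line.
  let P : Finset (MvPolynomial (Fin n) k) → MvPolynomial (Fin n) k → Prop := fun S h =>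
    ∃ I ∈ F, h ∈ B I ∧ slope i h ∉ S ∧ ∀ b ∈ B I, slopeRelation i h b ∈ S
  -- With the defaults 1 and 0, lines that no locus meets in a single point are left fixed.
  let den : Finset (MvPolynomial (Fin n) k) → MvPolynomial (Fin n) k := fun S =>
    if h : ∃ h, P S h then slope i h.choose else 1
  let num : Finset (MvPolynomial (Fin n) k) → MvPolynomial (Fin n) k := fun S =>
    if h : ∃ h, P S h then intercept i h.choose else 0
  let shift : (Fin n → K) → K := fun x =>
    aeval x (num (vanishingAt T x)) / aeval x (den (vanishingAt T x))
  have hden : ∀ x : Fin n → K, aeval x (den (vanishingAt T x)) ≠ 0 := by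
    intro x
    simp only [den]
    split_ifs with h
    · obtain ⟨I, hI, hh, hS, -⟩ := h.choose_spec
      exact fun h0 => hS (mem_vanishingAt.2 ⟨hTs I hI _ hh, h0⟩)
    · simp
  have hshift : ∀ x t, shift (Function.update x i t) = shift x := by
    intro x t
    simp only [shift, hT, num, den]
    split_ifs with h
    · rw [aeval_update_slope, aeval_update_intercept]
    · simp
  -- The chosen h may belong to another ideal J than I, but both loci meet the line in the same
  -- point, whose i-th coordinate is minus the shift.
  have key : ∀ x : Fin n → K, ∀ I ∈ F, ∀ h ∈ B I, x ∈ leadZeroLocus K i I →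
      aeval x (slope i h) ≠ 0 → x i + shift x = 0 := by
    intro x I hI h hh hx hne
    have hlin : ∀ b ∈ B I, x i * aeval x (slope i b) + aeval x (intercept i b) = 0 := fun b hb => by
      rw [← aeval_update_leadPart ((hB I hI).degree_apply_le_one hb i), Function.update_eq_self]
      exact hx b ((hB I hI).mem b hb)
    have hex : ∃ h, P (vanishingAt T x) h := by
      refine ⟨h, I, hI, hh, fun h0 => hne (mem_vanishingAt.1 h0).2, fun b hb =>
        mem_vanishingAt.2 ⟨hTr I hI h hh b hb, ?_⟩⟩
      rw [slopeRelation, map_sub, map_mul, map_mul]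
      linear_combination aeval x (slope i h) * hlin b hb - aeval x (slope i b) * hlin h hh
    have hs : shift x = aeval x (intercept i hex.choose) / aeval x (slope i hex.choose) := by
      simp only [shift, num, den, dif_pos hex]
    obtain ⟨J, hJ, hg, hgS, hrel⟩ := hex.choose_spec
    rw [hs]
    generalize hex.choose = g at hg hgS hrel
    have hgne : aeval x (slope i g) ≠ 0 := fun h0 => hgS (mem_vanishingAt.2 ⟨hTs J hJ g hg, h0⟩)
    have hmem : Function.update x i (-(aeval x (intercept i g) / aeval x (slope i g))) ∈
        leadZeroLocus K i J := fun u hu => by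
      refine (hB J hJ).aeval_leadPart_eq_zero (fun b hb => ?_) hu
      have h1 := (mem_vanishingAt.1 (hrel b hb)).2
      rw [slopeRelation, map_sub, map_mul, map_mul] at h1
      rw [aeval_update_leadPart ((hB J hJ).degree_apply_le_one hb i)]
      field_simp
      linear_combination h1
    rw [eq_of_aeval_slope_ne_zero (hF _ (hinf I hI J hJ)) (s := x i)
      (by rwa [Function.update_eq_self]) hmem ((hB I hI).mem h hh) ((hB J hJ).mem g hg) hne hgne]
    exact neg_add_cancel _
  refine ⟨fun x => Function.update x i (x i + shift x), ?_, ?_, ?_⟩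
  · refine Function.bijective_iff_has_inverse.2
      ⟨fun x => Function.update x i (x i - shift x), fun x => ?_, fun x => ?_⟩
    · simp only [hshift, Function.update_self, Function.update_idem, add_sub_cancel_right,
        Function.update_eq_self]
    · simp only [hshift, Function.update_self, Function.update_idem, sub_add_cancel,
        Function.update_eq_self]
  · refine ⟨T, den, fun S => Function.update (fun j => X j * den S) i (X i * den S + num S),
      fun x => ⟨hden x, fun j => ?_⟩⟩
    have h1 := hden x
    by_cases hj : j = i
    · subst hj
      simp only [Function.update_self, map_add, map_mul, aeval_X, shift]
      field_simp
    · simp only [Function.update_of_ne hj, map_mul, aeval_X]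
      field_simp
  · intro I hI x hx u hu
    refine (hB I hI).aeval_leadPart_eq_zero (fun h hh => ?_) hu
    have hd := (hB I hI).degree_apply_le_one hh i
    have h1 : x i * aeval x (slope i h) + aeval x (intercept i h) = 0 := by
      rw [← aeval_update_leadPart hd, Function.update_eq_self]
      exact hx h ((hB I hI).mem h hh)
    rcases Nat.le_one_iff_eq_zero_or_eq_one.1 hd with hd | hd
    · rw [aeval_update_leadPart_succ_of_eq_zero hd]
      rwa [slope, if_neg (by omega), map_zero, mul_zero, zero_add] at h1
    -- The next leading part is X i times the slope: either the slope vanishes, or the shear has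
    -- moved the point to X i = 0.
    · rw [aeval_update_leadPart_succ hd]
      by_cases h0 : aeval x (slope i h) = 0
      · rw [h0, mul_zero]
      · rw [key x I hI h hh hx h0, zero_mul]

theorem exists_bijective_mapsTo_leadZeroLocus_le
    (hF : ∀ I ∈ F, HasSquarefreeLeads MonomialOrder.lex I)
    (hinf : ∀ I ∈ F, ∀ J ∈ F, I ⊓ J ∈ F) (i : ℕ) (hi : i ≤ n) :
    ∃ φ : (Fin n → K) → (Fin n → K), Function.Bijective φ ∧ IsPiecewiseRational k φ ∧
      ∀ I ∈ F, Set.MapsTo φ (zeroLocus K I) (leadZeroLocus K i I) := by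
  induction i with
  | zero =>
    refine ⟨id, Function.bijective_id, isPiecewiseRational_id, fun I _ x hx u hu => ?_⟩
    rw [leadPart_zero_left]
    exact hx u hu
  | succ i ih =>
    obtain ⟨φ, h1, h2, h3⟩ := ih (Nat.le_of_succ_le hi)
    obtain ⟨ψ, h4, h5, h6⟩ :=
      exists_bijective_mapsTo_leadZeroLocus (K := K) hF hinf ⟨i, Nat.lt_of_succ_le hi⟩
    exact ⟨ψ ∘ φ, h4.comp h1, h5.comp h2, fun I hI => (h6 I hI).comp (h3 I hI)⟩

theorem hasBijectionIntoInitial (hF : ∀ I ∈ F, HasSquarefreeLeads MonomialOrder.lex I)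
    (hinf : ∀ I ∈ F, ∀ J ∈ F, I ⊓ J ∈ F) : HasBijectionIntoInitial k F := by
  obtain ⟨φ, h1, h2, h3⟩ := exists_bijective_mapsTo_leadZeroLocus_le
    (K := AlgebraicClosure k) hF hinf n le_rfl
  refine ⟨φ, h1, h2.isConstructibleMap, fun I hI x hx => ?_⟩
  rw [initialIdeal, zeroLocus_span]
  rintro _ ⟨u, hu, rfl⟩
  have h4 := h3 I hI hx u hu
  rwa [leadPart_self] at h4

end Bijection

end FrobDegen

end

theorem theorem1p7 (n : ℕ) (f : MvPolynomial (Fin n) ℤ)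
    (c : ℤ) (hc : c ≠ 0) (A : Finset (Fin n))
    (hlead : MonomialOrder.lex.leadingTerm f = MvPolynomial.C c * ∏ i ∈ A, MvPolynomial.X i)
    (hdeg : f.totalDegree = A.card) :
    ∃ N : ℕ, N ≠ 0 ∧
      -- over `ℤ[1/N]`
      (∀ I, FrobDegen.Constructed f I →
        FrobDegen.IsReducedWithSRInitial
          (FrobDegen.baseChange (algebraMap ℤ (Localization.Away (N : ℤ))) I)) ∧
      -- over `ℚ`
      (∀ I ∈ FrobDegen.rationalFamily f, FrobDegen.IsReducedWithSRInitial I) ∧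
      FrobDegen.HasBijectionIntoInitial ℚ (FrobDegen.rationalFamily f) ∧
      -- over `𝔽_p`, for all primes not dividing `N`
      ∀ (p : ℕ) [Fact p.Prime], ¬ p ∣ N →
        (∀ I ∈ FrobDegen.modPFamily p f, FrobDegen.IsReducedWithSRInitial I) ∧
        FrobDegen.HasBijectionIntoInitial (ZMod p) (FrobDegen.modPFamily p f) := by
  classical
  rw [← FrobDegen.monomial_squarefreeExp, C_mul_monomial, mul_one] at hlead
  have hdegree : MonomialOrder.lex.degree f = FrobDegen.squarefreeExp A := by
    rw [← MonomialOrder.degree_leadingTerm, hlead, MonomialOrder.degree_monomial, if_neg hc]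
  have hf : f ≠ 0 := by
    rintro rfl
    rw [MonomialOrder.leadingTerm_zero] at hlead
    exact hc (monomial_eq_zero.1 hlead.symm)
  obtain ⟨N, hN, h⟩ := FrobDegen.exists_isGoodModulus hf hdegree
  refine ⟨N, hN, fun I hI => h.isReducedWithSRInitial hN hI,
    fun J hJ => (FrobDegen.hasSquarefreeLeads_of_mem_rationalFamily hf hdegree
      hJ).isReducedWithSRInitial,
    FrobDegen.hasBijectionIntoInitial
      (fun J hJ => FrobDegen.hasSquarefreeLeads_of_mem_rationalFamily hf hdegree hJ)
      fun I hI J hJ => FrobDegen.inf_mem_rationalFamily hI hJ,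
    fun p hp hpN => ?_⟩
  obtain ⟨h1, h2⟩ := FrobDegen.map_zmod_ne_zero (h.not_dvd p hp.out hpN)
  have hsplit : ∀ I, FrobDegen.IsCompatiblySplit p (map (Int.castRingHom (ZMod p)) f) I →
      FrobDegen.HasSquarefreeLeads MonomialOrder.lex I :=
    fun I hI => hI.hasSquarefreeLeads h1 (h2.trans hdegree)
  have hmem : ∀ I ∈ FrobDegen.modPFamily p f,
      FrobDegen.IsCompatiblySplit p (map (Int.castRingHom (ZMod p)) f) I :=
    fun I hI => h.isCompatiblySplit_of_mem_modPFamily hdegree hpN hI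
  refine ⟨fun I hI => (hsplit I (hmem I hI)).isReducedWithSRInitial, ?_⟩
  -- The construction is run on all compatibly split ideals, a family closed under intersection that
  -- contains `modPFamily p f`.
  obtain ⟨φ, h3, h4, h5⟩ := FrobDegen.hasBijectionIntoInitial
    (F := {I | FrobDegen.IsCompatiblySplit p (map (Int.castRingHom (ZMod p)) f) I})
    hsplit fun I hI J hJ => hI.inf hJ
  exact ⟨φ, h3, h4, fun I hI => h5 I (hmem I hI)⟩
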